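/- All ordered sets considered are finite, have a minimum element, and have all maximal chains of the same length; for such an ordered set $P$ let $r(x)$ be the maximum length $|C|-1$ of a chain $C\subseteq P$ with maximum element $x$, and let $r(P)=\max_{x\in P} r(x)$. A chain $x_1<x_2<\dots<x_k$ in $P$ is symmetric if it is saturated (no element of $P$ lies strictly between $x_i$ and $x_{i+1}$, for every $i$) and $r(x_1)+r(x_k)=r(P)$. Call $P$ a symmetric chain order if it can be partitioned into symmetric chains. For a group $G$ of automorphisms of an ordered set $Q$, the quotient $Q/G$ is the set of $G$-orbits, ordered by $[x]\le[y]$ if $x'\le y'$ for some $x'\in[x]$ and $y'\in[y]$. **Theorem.** Let $P$ be a symmetric chain order, let $n\ge 0$ be an integer, and let $G$ be a subgroup of the symmetric group $S_n$ generated by powers of disjoint cycles, that is, $G=\langle \sigma_1^{r_1},\dots,\sigma_m^{r_m}\rangle$ for some $m \ge 0$, some pairwise disjoint cycles $\sigma_1,\dots,\sigma_m\in S_n$ and some non-negative integers $r_1,\dots,r_m$. Let $G$ act on $P^n$ (ordered coordinatewise) by permuting coordinates, $\sigma(p_1,\dots,p_n)=(p_{\sigma^{-1}(1)},\dots,p_{\sigma^{-1}(n)})$.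 Then $P^n/G$ is a symmetric chain order (in particular, it is an ordered set with a minimum element in which all maximal chains have the same length). -/

import Mathlib

/-! ### Symmetric chain orders -/

section SymmetricChainOrders

variable (P : Type*) [PartialOrder P]

/-- Ranked orders: finite ordered sets with a minimum element in which all maximal chains
have the same length (equivalently, the same number of elements). -/
structure IsRanked : Prop where
  finite : Finite P
  exists_min : ∃ z : P, ∀ x, z ≤ x
  card_maxChain : ∀ C D : Set P, IsMaxChain (· ≤ ·) C → IsMaxChain (· ≤ ·) D → C.ncard = D.ncard

variable {P}

/-- The rank `r(x)`: the maximal length of a chain with maximum element `x`. -/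
noncomputable def posetRank (x : P) : ℕ∞ := Order.height x

variable (P) in
/-- The rank `r(P)`: the maximum of `r(x)` over all `x`. -/
noncomputable def totalRank : ℕ∞ := ⨆ x : P, posetRank x

/-- `C` is a saturated chain `x 0 ⋖ x 1 ⋖ ⋯ ⋖ x k` with `r(x 0) + r(x k) = r(P)`. -/
def IsSymmetricChain (C : Set P) : Prop :=
  ∃ (k : ℕ) (x : Fin (k + 1) → P),
    (∀ i : Fin k, x i.castSucc ⋖ x i.succ) ∧
    posetRank (x 0) + posetRank (x (Fin.last k)) = totalRank P ∧
    C = Set.range x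

/-- A symmetric chain decomposition: a partition into symmetric chains. -/
def IsSCD (𝒞 : Set (Set P)) : Prop :=
  Setoid.IsPartition 𝒞 ∧ ∀ C ∈ 𝒞, IsSymmetricChain C

variable (P) in
/-- A symmetric chain order: a ranked order that has a symmetric chain decomposition. -/
def IsSCO : Prop := IsRanked P ∧ ∃ 𝒞 : Set (Set P), IsSCD 𝒞

end SymmetricChainOrders

/-! ### Quotients of ordered sets -/

section Quotients

variable {X : Type*} [PartialOrder X]

/-- The set `X/H` of orbits of a group `H` of automorphisms of the ordered set `X`. -/
def OrbitPoset (H : Subgroup (X ≃o X)) : Type _ := MulAction.orbitRel.Quotient H X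

/-- The orbit `[x]`. -/
def OrbitPoset.mk (H : Subgroup (X ≃o X)) (x : X) : OrbitPoset H :=
  Quotient.mk (MulAction.orbitRel H X) x

theorem OrbitPoset.mk_eq_mk {H : Subgroup (X ≃o X)} {x y : X} :
    OrbitPoset.mk H x = OrbitPoset.mk H y ↔ ∃ h ∈ H, h y = x := by
  refine (Quotient.eq (r := MulAction.orbitRel H X)).trans ?_
  rw [MulAction.orbitRel_apply, MulAction.mem_orbit_iff]
  exact ⟨fun ⟨h, hh⟩ => ⟨h.1, h.2, hh⟩, fun ⟨h, hm, hh⟩ => ⟨⟨h, hm⟩, hh⟩⟩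

theorem OrbitPoset.exists_mk {H : Subgroup (X ≃o X)} (a : OrbitPoset H) :
    ∃ x, OrbitPoset.mk H x = a := Quotient.exists_rep a

/-- `a ≤ b` in `X/H` if `x ≤ y` for some elements `x` of the orbit `a` and `y` of the orbit `b`. -/
instance OrbitPoset.instLE (H : Subgroup (X ≃o X)) : LE (OrbitPoset H) where
  le a b := ∃ x y : X, OrbitPoset.mk H x = a ∧ OrbitPoset.mk H y = b ∧ x ≤ y

theorem OrbitPoset.mk_le_mk {H : Subgroup (X ≃o X)} {x y : X} :
    OrbitPoset.mk H x ≤ OrbitPoset.mk H y ↔ ∃ h ∈ H, x ≤ h y := by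
  constructor
  · rintro ⟨x', y', hx, hy, hle⟩
    obtain ⟨g, hg, rfl⟩ := OrbitPoset.mk_eq_mk.1 hx
    obtain ⟨k, hk, rfl⟩ := OrbitPoset.mk_eq_mk.1 hy
    refine ⟨g⁻¹ * k, H.mul_mem (H.inv_mem hg) hk, ?_⟩
    have h1 := g.symm.monotone hle
    rwa [g.symm_apply_apply] at h1
  · rintro ⟨h, hh, hle⟩
    exact ⟨x, h y, rfl, OrbitPoset.mk_eq_mk.2 ⟨h, hh, rfl⟩, hle⟩

theorem OrbitPoset.eq_of_le_apply {H : Subgroup (X ≃o X)} [Finite H] {x : X} {h : X ≃o X}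
    (hh : h ∈ H) (hle : x ≤ h x) : h x = x := by
  have key : ∀ m : ℕ, h x ≤ (h ^ (m + 1)) x := by
    intro m
    induction m with
    | zero => simp
    | succ m ih =>
      rw [pow_succ']
      exact h.monotone (hle.trans ih)
  obtain ⟨m, hm, hp⟩ := isOfFinOrder_iff_pow_eq_one.1 (isOfFinOrder_of_finite (⟨h, hh⟩ : H))
  have hp' : h ^ m = 1 := congrArg Subtype.val hp
  obtain ⟨k, rfl⟩ : ∃ k, m = k + 1 := ⟨m - 1, by omega⟩
  have h2 := key k
  rw [hp'] at h2
  exact le_antisymm h2 hle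

/-- The quotient of an ordered set by a finite group of automorphisms is an ordered set. -/
instance OrbitPoset.instPartialOrder (H : Subgroup (X ≃o X)) [Finite H] :
    PartialOrder (OrbitPoset H) where
  le := (· ≤ ·)
  le_refl a := by
    obtain ⟨x, rfl⟩ := a.exists_mk
    exact OrbitPoset.mk_le_mk.2 ⟨1, H.one_mem, le_rfl⟩
  le_trans a b c hab hbc := by
    obtain ⟨x, rfl⟩ := a.exists_mk
    obtain ⟨y, rfl⟩ := b.exists_mk
    obtain ⟨z, rfl⟩ := c.exists_mk
    obtain ⟨g, hg, h1⟩ := OrbitPoset.mk_le_mk.1 hab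
    obtain ⟨k, hk, h2⟩ := OrbitPoset.mk_le_mk.1 hbc
    exact OrbitPoset.mk_le_mk.2 ⟨g * k, H.mul_mem hg hk, h1.trans (g.monotone h2)⟩
  le_antisymm a b hab hba := by
    obtain ⟨x, rfl⟩ := a.exists_mk
    obtain ⟨y, rfl⟩ := b.exists_mk
    obtain ⟨g, hg, h1⟩ := OrbitPoset.mk_le_mk.1 hab
    obtain ⟨k, hk, h2⟩ := OrbitPoset.mk_le_mk.1 hba
    have h3 : g (k x) = x :=
      OrbitPoset.eq_of_le_apply (h := g * k) (H.mul_mem hg hk) (h1.trans (g.monotone h2))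
    refine OrbitPoset.mk_eq_mk.2 ⟨g, hg, le_antisymm ?_ h1⟩
    exact (g.monotone h2).trans h3.le

end Quotients

/-! ### Permuting the coordinates of a power -/

section Powers

/-- The action of `S_n` on `P^n` by permuting coordinates,
`σ (p₁, …, pₙ) = (p_{σ⁻¹(1)}, …, p_{σ⁻¹(n)})`, as a homomorphism to the automorphism group. -/
def permCoords (P : Type*) [PartialOrder P] (n : ℕ) :
    Equiv.Perm (Fin n) →* ((Fin n → P) ≃o (Fin n → P)) where
  toFun σ :=
    { toFun := fun p i => p (σ⁻¹ i)
      invFun := fun p i => p (σ i)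
      left_inv := fun p => by funext i; simp
      right_inv := fun p => by funext i; simp
      map_rel_iff' := fun {p q} =>
        ⟨fun h i => by simpa using h (σ i), fun h i => h (σ⁻¹ i)⟩ }
  map_one' := rfl
  map_mul' σ τ := by
    ext p i
    change p ((σ * τ)⁻¹ i) = p (τ⁻¹ (σ⁻¹ i))
    rw [mul_inv_rev, Equiv.Perm.mul_apply]

instance finite_map_permCoords (P : Type*) [PartialOrder P] (n : ℕ)
    (G : Subgroup (Equiv.Perm (Fin n))) : Finite (G.map (permCoords P n)) :=
  (Set.toFinite ((permCoords P n) '' (G : Set (Equiv.Perm (Fin n))))).to_subtype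

/-- The quotient `P^n/G` of the power `P^n` (ordered coordinatewise) by `G ≤ S_n`. -/
abbrev PowerQuotient (P : Type*) [PartialOrder P] {n : ℕ}
    (G : Subgroup (Equiv.Perm (Fin n))) : Type _ :=
  OrbitPoset (G.map (permCoords P n))

/-- `G` is generated by powers of disjoint cycles: `G = ⟨σ₁^{r₁}, …, σₘ^{rₘ}⟩` for some
pairwise disjoint cycles `σ₁, …, σₘ`. -/
def GeneratedByPowersOfDisjointCycles {n : ℕ} (G : Subgroup (Equiv.Perm (Fin n))) : Prop :=
  ∃ (m : ℕ) (σ : Fin m → Equiv.Perm (Fin n)) (r : Fin m → ℕ),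
    (∀ i, (σ i).IsCycle) ∧
    (∀ i j, i ≠ j → (σ i).Disjoint (σ j)) ∧
    G = Subgroup.closure (Set.range fun i => σ i ^ r i)

end Powers

/-!
Take a symmetric chain decomposition of `P`. Since the generators are powers of disjoint cycles,
`P ^ n / G` is the product, over the cycles `c` (fixed points counting as cycles of length one), of
the quotients of `P ^ k` by rotations by multiples of some `r`, where `k` is the length of `c`
(`CycleCoords`). Products of symmetric chain orders are symmetric chain orders, rectangles being
unions of hooks (`SymmChainData.prod`), so everything rests on a single cycle
(`SymmChainData.nonempty_periodicSeq`). There, functions on the cycle are treated as `k`-periodic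
sequences on `ℤ`.

Record an element of a chain of length `m` at level `x` as a block of `x` down steps followed by
`m - x` up steps. A periodic sequence in `P` becomes a periodic bracket word, in which an up step is
matched with the next down step that returns to its height. Below the middle rank, unmatched steps
are all up steps, and there are `u = N k - 2 * rank` of them per period. Turning all of them into
down steps is a bijection, `mirror`, from the lower half onto the upper half (a Pitman transform:
the valleys `V` turn into `max V W - 2 W`, where `W` is the minimum of the future, and `W` is
recovered as the minimum of the past). For `u ≥ 2`, choose a widest gap between cyclically
consecutive unmatched blocks, and turn the first unmatched up step at its right end into a down
step. The step so produced is matched across the gap by an arc that is strictly heavier than all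
other arcs, as these lie within the gaps; so the raised block can be recovered, and raising is
injective (`IsWidestGap.dvd_sub_of_raiseAt_eq`). Moreover raising only takes the up step at the left
end of the gap away from the mirror image (`mirror_raiseAt_le`). All this commutes with rotations,
except that a choice among the widest gaps has to be made; this choice is made once per orbit, and
injectivity on orbits persists because it holds for any choice of gaps. The chains of the quotient
start at the elements that do not arise by raising, climb by raising up to the middle, and go on
through the mirror images of what they passed, in reverse order (`SymmChainData.ofRaise`).

No matching is ever constructed: blocks and gaps are read off from the heights of the valleys.
-/

universe u

/-! ### Integer sequences and their prefix sums -/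

section Sequences

/-- The prefix sums of a sequence `x : ℤ → ℤ`, normalised by `prefixSum x 0 = 0`; the increment
from `i` to `i + 1` is `x (i + 1)`, also for negative `i`. -/
noncomputable def prefixSum (x : ℤ → ℤ) (i : ℤ) : ℤ :=
  ∑ l ∈ Finset.Ioc 0 i, x l - ∑ l ∈ Finset.Ioc i 0, x l

theorem prefixSum_add_one (x : ℤ → ℤ) (i : ℤ) :
    prefixSum x (i + 1) = prefixSum x i + x (i + 1) := by
  unfold prefixSum
  rcases le_or_gt 0 i with h | h
  · have h1 : Finset.Ioc 0 (i + 1) = insert (i + 1) (Finset.Ioc 0 i) := by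
      ext l; simp only [Finset.mem_Ioc, Finset.mem_insert]; omega
    rw [h1, Finset.sum_insert (by simp), Finset.Ioc_eq_empty (a := i + 1) (by omega),
      Finset.Ioc_eq_empty (a := i) (by omega)]
    simp [add_comm]
  · have h1 : Finset.Ioc i 0 = insert (i + 1) (Finset.Ioc (i + 1) 0) := by
      ext l; simp only [Finset.mem_Ioc, Finset.mem_insert]; omega
    rw [h1, Finset.sum_insert (by simp), Finset.Ioc_eq_empty (b := i + 1) (by omega),
      Finset.Ioc_eq_empty (b := i) (by omega)]
    simp

theorem prefixSum_zero (x : ℤ → ℤ) : prefixSum x 0 = 0 := by simp [prefixSum]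

theorem prefixSum_of_nonneg (x : ℤ → ℤ) {k : ℤ} (hk : 0 ≤ k) :
    prefixSum x k = ∑ l ∈ Finset.Ioc 0 k, x l := by
  unfold prefixSum
  rw [Finset.Ioc_eq_empty (a := k) (by omega)]
  simp

/-- Two integer sequences with the same increments differ by a constant. -/
theorem sub_eq_sub_of_increment_eq {f g : ℤ → ℤ}
    (h : ∀ i, f (i + 1) - f i = g (i + 1) - g i) (i j : ℤ) : f i - f j = g i - g j := by
  have key : ∀ i, f i - g i = f 0 - g 0 := by
    intro i
    induction i using Int.induction_on with
    | zero => rfl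
    | succ i ih => have := h i; omega
    | pred i ih =>
      have := h (-i - 1)
      rw [sub_add_cancel] at this
      omega
  have h1 := key i
  have h2 := key j
  omega

theorem prefixSum_add_period {x : ℤ → ℤ} {k : ℤ} (hx : ∀ i, x (i + k) = x i) (i : ℤ) :
    prefixSum x (i + k) = prefixSum x i + prefixSum x k := by
  have h := sub_eq_sub_of_increment_eq (f := fun i => prefixSum x (i + k)) (g := prefixSum x)
    (fun i => by
      have h1 := prefixSum_add_one x (i + k)
      have h2 := prefixSum_add_one x i
      have h3 := hx (i + 1)
      rw [show i + 1 + k = i + k + 1 by ring] at h3 ⊢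
      omega) i 0
  simp only [zero_add, prefixSum_zero] at h
  omega

theorem prefixSum_mono {x : ℤ → ℤ} (hx : ∀ i, 0 ≤ x i) : Monotone (prefixSum x) :=
  monotone_int_of_le_succ fun i => by
    have := prefixSum_add_one x i
    have := hx (i + 1)
    omega

theorem apply_add_mul_period {V : ℤ → ℤ} {k u : ℤ} (hV : ∀ i, V (i + k) = V i + u) (i t : ℤ) :
    V (i + t * k) = V i + t * u := by
  induction t using Int.induction_on with
  | zero => simp
  | succ t ih =>
    have h := hV (i + t * k)
    rw [show i + (t + 1 : ℤ) * k = i + t * k + k by ring, h, ih]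
    ring
  | pred t ih =>
    have h := hV (i + (-t - 1 : ℤ) * k)
    rw [show i + (-t - 1 : ℤ) * k + k = i + -t * k by ring, ih] at h
    linarith

theorem exists_window {k : ℤ} (hk : 0 < k) (i l : ℤ) :
    ∃ l' t, i < l' ∧ l' ≤ i + k ∧ l = l' + t * k ∧ (i < l → 0 ≤ t) := by
  have h1 := Int.emod_add_mul_ediv (l - i - 1) k
  have h2 := Int.emod_nonneg (l - i - 1) hk.ne'
  have h3 := Int.emod_lt_of_pos (l - i - 1) hk
  exact ⟨i + 1 + (l - i - 1) % k, (l - i - 1) / k, by omega, by omega, by linarith,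
    fun h => Int.ediv_nonneg (by omega) hk.le⟩

theorem le_of_forall_window {V : ℤ → ℤ} {k u : ℤ} (hk : 0 < k) (hu : 0 ≤ u)
    (hV : ∀ i, V (i + k) = V i + u) {i B : ℤ} (h : ∀ l, i < l → l ≤ i + k → B ≤ V l) (l : ℤ)
    (hl : i < l) : B ≤ V l := by
  obtain ⟨l', t, h1, h2, rfl, h3⟩ := exists_window hk i l
  have h4 := mul_nonneg (h3 hl) hu
  have h5 := apply_add_mul_period hV l' t
  have h6 := h l' h1 h2
  omega

/-- A sequence with non-negative drift attains its minimum on every final segment. -/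
theorem exists_forall_gt_le {V : ℤ → ℤ} {k u : ℤ} (hk : 0 < k) (hu : 0 ≤ u)
    (hV : ∀ i, V (i + k) = V i + u) (i : ℤ) : ∃ l, i < l ∧ ∀ l', i < l' → V l ≤ V l' := by
  obtain ⟨l, hl, hmin⟩ := (Finset.Ioc i (i + k)).exists_min_image V
    ⟨i + k, by simp [hk]⟩
  simp only [Finset.mem_Ioc] at hl hmin
  exact ⟨l, hl.1, le_of_forall_window hk hu hV fun l' h1 h2 => hmin l' ⟨h1, h2⟩⟩

/-- A sequence with positive drift lies above any given level from some time on. -/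
theorem exists_last_le {V : ℤ → ℤ} {k u : ℤ} (hk : 0 < k) (hu : 0 < u)
    (hV : ∀ i, V (i + k) = V i + u) {h j : ℤ} (hj : V j ≤ h) :
    ∃ l, j ≤ l ∧ V l ≤ h ∧ ∀ l', l < l' → h < V l' := by
  obtain ⟨l0, hl0, hmin⟩ := exists_forall_gt_le hk hu.le hV j
  have hbd : ∀ z, (j ≤ z ∧ V z ≤ h) → z ≤ j + (|h - V l0| + 1) * k := by
    rintro z ⟨hz, hz'⟩
    by_contra! hlt
    have h1 := hmin (z - (|h - V l0| + 1) * k) (by linarith)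
    have h2 := apply_add_mul_period hV (z - (|h - V l0| + 1) * k) (|h - V l0| + 1)
    rw [sub_add_cancel] at h2
    have h3 := le_abs_self (h - V l0)
    have h4 : (|h - V l0| + 1) * 1 ≤ (|h - V l0| + 1) * u :=
      mul_le_mul_of_nonneg_left (by omega) (by positivity)
    linarith
  obtain ⟨l, ⟨hl, hl'⟩, hgr⟩ := Int.exists_greatest_of_bdd ⟨_, hbd⟩ ⟨j, le_rfl, hj⟩
  refine ⟨l, hl, hl', fun l' hl' => ?_⟩
  by_contra! hcon
  have := hgr l' ⟨by omega, hcon⟩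
  omega

end Sequences

/-! ### Valleys of a cyclic bracket word -/

section Valleys

/-- The height, up to a constant, of the `i`-th valley of the lattice path whose `i`-th block goes
down `x i` steps and then up `m i - x i` steps. -/
noncomputable def valley (m x : ℤ → ℤ) (i : ℤ) : ℤ :=
  prefixSum m (i - 1) - prefixSum x i - prefixSum x (i - 1)

theorem valley_add_one (m x : ℤ → ℤ) (i : ℤ) :
    valley m x (i + 1) = valley m x i + (m i - x i) - x (i + 1) := by
  have h1 := prefixSum_add_one m (i - 1)
  have h2 := prefixSum_add_one x (i - 1)
  have h3 := prefixSum_add_one x i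
  unfold valley
  rw [sub_add_cancel] at h1 h2
  rw [add_sub_cancel_right]
  omega

theorem valley_add_period {m x : ℤ → ℤ} {k : ℤ} (hm : ∀ i, m (i + k) = m i)
    (hx : ∀ i, x (i + k) = x i) (i : ℤ) :
    valley m x (i + k) = valley m x i + (prefixSum m k - 2 * prefixSum x k) := by
  unfold valley
  rw [show i + k - 1 = i - 1 + k by ring, prefixSum_add_period hm, prefixSum_add_period hx,
    prefixSum_add_period hx]
  ring

/-- Two consecutive unmatched blocks: `j` is a block whose valley is lower than all later
ones, and `i` is the last earlier block with a valley lower than that of `j`. -/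
structure IsGap (V : ℤ → ℤ) (i j : ℤ) : Prop where
  lt : i < j
  val_lt : V i < V j
  le_of_between : ∀ l, i < l → l < j → V j ≤ V l
  lt_of_gt : ∀ l, j < l → V j < V l

/-- `i` is the last block before `j` whose valley is not higher than that of `j`. If `j` has a down
step, then `i` contains the up step matched with the last one of these. -/
structure IsArc (V : ℤ → ℤ) (i j : ℤ) : Prop where
  lt : i < j
  val_le : V i ≤ V j
  lt_of_between : ∀ l, i < l → l < j → V j < V l

/-- A gap `(i, j)` of maximal weight, the weight being the sum of `x` over the blocks after `i`
up to `j`, that is, the number of matched pairs inside the gap. -/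
structure IsWidestGap (m x : ℤ → ℤ) (i j : ℤ) : Prop where
  gap : IsGap (valley m x) i j
  max : ∀ i' j', IsGap (valley m x) i' j' →
    prefixSum x j' - prefixSum x i' ≤ prefixSum x j - prefixSum x i

theorem IsGap.exists_of_record {V : ℤ → ℤ} {k u : ℤ} (hk : 0 < k) (hu : 0 < u)
    (hV : ∀ i, V (i + k) = V i + u) {j : ℤ} (hj : ∀ l, j < l → V j < V l) :
    ∃ i, IsGap V i j := by
  have h1 := hV (j - k)
  rw [sub_add_cancel] at h1
  obtain ⟨i, ⟨h2, h3⟩, h4⟩ := Int.exists_greatest_of_bdd (P := fun i => i < j ∧ V i < V j)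
    ⟨j, fun z hz => hz.1.le⟩ ⟨j - k, by omega, by omega⟩
  refine ⟨i, h2, h3, fun l hl hlj => ?_, hj⟩
  by_contra! hcon
  have := h4 l ⟨hlj, hcon⟩
  omega

theorem IsGap.sub_period_le {V : ℤ → ℤ} {k u : ℤ} (hk : 0 < k) (hu : 0 < u)
    (hV : ∀ i, V (i + k) = V i + u) {i j : ℤ} (h : IsGap V i j) : j - k ≤ i := by
  by_contra! hcon
  have h1 := h.le_of_between (j - k) hcon (by omega)
  have h2 := hV (j - k)
  rw [sub_add_cancel] at h2
  omega

theorem IsGap.record_left {V : ℤ → ℤ} {i j : ℤ} (h : IsGap V i j) :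
    ∀ l, i < l → V i < V l := by
  intro l hl
  rcases lt_trichotomy l j with h1 | rfl | h1
  · exact h.val_lt.trans_le (h.le_of_between l hl h1)
  · exact h.val_lt
  · exact h.val_lt.trans (h.lt_of_gt l h1)

theorem exists_isWidestGap {m x : ℤ → ℤ} {k : ℤ} (hk : 0 < k) (hm : ∀ i, m (i + k) = m i)
    (hx : ∀ i, x (i + k) = x i) (hx0 : ∀ i, 0 ≤ x i)
    (hu : 0 < prefixSum m k - 2 * prefixSum x k) : ∃ i j, IsWidestGap m x i j := by
  have hV := valley_add_period hm hx
  obtain ⟨j, -, h1, h2⟩ := exists_last_le hk hu hV (le_refl (valley m x 0))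
  obtain ⟨i, hij⟩ := IsGap.exists_of_record hk hu hV (j := j) fun l hl => h1.trans_lt (h2 l hl)
  obtain ⟨w, ⟨i', j', hg, rfl⟩, hmax⟩ := Int.exists_greatest_of_bdd
    (P := fun w => ∃ i j, IsGap (valley m x) i j ∧ w = prefixSum x j - prefixSum x i)
    ⟨prefixSum x k, by
      rintro _ ⟨i, j, hg, rfl⟩
      have h3 := prefixSum_mono hx0 (hg.sub_period_le hk hu hV)
      have h4 := prefixSum_add_period hx (j - k)
      rw [sub_add_cancel] at h4
      omega⟩ ⟨_, i, j, hij, rfl⟩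
  exact ⟨i', j', hg, fun i j h => hmax _ ⟨i, j, h, rfl⟩⟩

/-- The sequence `x` with the entries at positions congruent to `j` modulo `k` raised by one. -/
def raiseAt (k : ℤ) (x : ℤ → ℤ) (j : ℤ) (i : ℤ) : ℤ := x i + if k ∣ i - j then 1 else 0

theorem ediv_add_one_sub {k : ℤ} (hk : 0 < k) (a : ℤ) :
    (a + 1) / k - a / k = if k ∣ a + 1 then 1 else 0 := by
  have h1 := Int.emod_add_mul_ediv a k
  have h2 := Int.emod_nonneg a hk.ne'
  have h3 := Int.emod_lt_of_pos a hk
  by_cases h : a % k + 1 = k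
  · have h4 : a + 1 = (a / k + 1) * k := by linarith
    rw [if_pos ⟨_, by rw [h4, mul_comm]⟩, h4, Int.mul_ediv_cancel _ hk.ne']
    omega
  · have h4 : (a + 1) / k = a / k := by
      rw [Int.ediv_eq_iff_of_pos hk]
      constructor <;> linarith [show a % k + 1 < k by omega]
    rw [h4, if_neg, sub_self]
    intro hd
    have h5 := Int.ediv_mul_cancel hd
    rw [h4] at h5
    linarith

theorem prefixSum_raiseAt {k : ℤ} (hk : 0 < k) (x : ℤ → ℤ) (j a b : ℤ) :
    prefixSum (raiseAt k x j) a - prefixSum (raiseAt k x j) b =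
      prefixSum x a + (a - j) / k - (prefixSum x b + (b - j) / k) := by
  refine sub_eq_sub_of_increment_eq (g := fun a => prefixSum x a + (a - j) / k) (fun i => ?_) a b
  have h1 := ediv_add_one_sub hk (i - j)
  rw [prefixSum_add_one, prefixSum_add_one, raiseAt, show i + 1 - j = i - j + 1 by ring]
  omega

theorem raiseAt_add_period {k : ℤ} {x : ℤ → ℤ} (hx : ∀ i, x (i + k) = x i) (j i : ℤ) :
    raiseAt k x j (i + k) = raiseAt k x j i := by
  have : k ∣ i + k - j ↔ k ∣ i - j := by
    rw [show i + k - j = i - j + k by ring]; exact dvd_add_self_right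
  simp only [raiseAt, hx, this]

theorem prefixSum_raiseAt_period {k : ℤ} (hk : 0 < k) (x : ℤ → ℤ) (j : ℤ) :
    prefixSum (raiseAt k x j) k = prefixSum x k + 1 := by
  have h := prefixSum_raiseAt hk x j k 0
  rw [prefixSum_zero, prefixSum_zero, show k - j = 0 - j + 1 * k by ring,
    Int.add_mul_ediv_right _ _ hk.ne'] at h
  omega

theorem ediv_eq_neg_one {k a : ℤ} (hk : 0 < k) (h1 : -k ≤ a) (h2 : a < 0) : a / k = -1 := by
  rw [Int.ediv_eq_iff_of_pos hk]
  constructor <;> linarith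

/-- Raising `x` at `j` lowers, up to a constant, the valley at `j` by one and leaves those
between `j - k` and `j` as they are. -/
theorem valley_raiseAt {k : ℤ} (hk : 0 < k) (m x : ℤ → ℤ) (j : ℤ) :
    ∃ c, (∀ a, j - k < a → a < j → valley m (raiseAt k x j) a = valley m x a + c) ∧
      valley m (raiseAt k x j) j = valley m x j + c - 1 ∧
      valley m (raiseAt k x j) (j - k) = valley m x (j - k) + c + 1 := by
  have key : ∀ a, valley m (raiseAt k x j) a - valley m (raiseAt k x j) j =
      valley m x a - valley m x j - (a - j) / k - (a - 1 - j) / k - 1 := by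
    intro a
    have h1 := prefixSum_raiseAt hk x j a j
    have h2 := prefixSum_raiseAt hk x j (a - 1) (j - 1)
    have h3 : (j - 1 - j) / k = -1 := ediv_eq_neg_one hk (by omega) (by omega)
    rw [sub_self, Int.zero_ediv] at h1
    unfold valley
    omega
  refine ⟨valley m (raiseAt k x j) j - valley m x j + 1, fun a h1 h2 => ?_, by ring, ?_⟩
  · have h3 := key a
    rw [ediv_eq_neg_one (a := a - j) hk (by omega) (by omega),
      ediv_eq_neg_one (a := a - 1 - j) hk (by omega) (by omega)] at h3
    omega
  · have h3 := key (j - k)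
    rw [ediv_eq_neg_one (a := j - k - j) hk (by omega) (by omega)] at h3
    have h4 : (j - k - 1 - j) / k = -2 := by
      rw [Int.ediv_eq_iff_of_pos hk]
      constructor <;> linarith
    omega

theorem IsArc.add_mul {V : ℤ → ℤ} {k u : ℤ} (hV : ∀ i, V (i + k) = V i + u) {i j : ℤ}
    (h : IsArc V i j) (t : ℤ) : IsArc V (i + t * k) (j + t * k) where
  lt := by linarith [h.lt]
  val_le := by
    rw [apply_add_mul_period hV, apply_add_mul_period hV]
    linarith [h.val_le]
  lt_of_between l h1 h2 := by
    have h3 := h.lt_of_between (l - t * k) (by linarith) (by linarith)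
    have h4 := apply_add_mul_period hV (l - t * k) t
    rw [sub_add_cancel] at h4
    rw [apply_add_mul_period hV, h4]
    linarith

/-- Raising at the right end of a widest gap turns the gap into an arc whose weight is larger
by one. -/
theorem IsWidestGap.isArc_raiseAt {m x : ℤ → ℤ} {k : ℤ} (hk : 0 < k) (hm : ∀ i, m (i + k) = m i)
    (hx : ∀ i, x (i + k) = x i) (hu : 2 ≤ prefixSum m k - 2 * prefixSum x k) {i j : ℤ}
    (h : IsWidestGap m x i j) :
    IsArc (valley m (raiseAt k x j)) i j ∧
      prefixSum (raiseAt k x j) j - prefixSum (raiseAt k x j) i =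
        prefixSum x j - prefixSum x i + 1 := by
  have hV := valley_add_period hm hx
  have hjk := hV (j - k)
  rw [sub_add_cancel] at hjk
  obtain ⟨c, h1, h2, h3⟩ := valley_raiseAt hk m x j
  have h4 := h.gap.sub_period_le hk (by omega) hV
  have h5 := h.gap.lt
  have h6 := h.gap.val_lt
  refine ⟨⟨h5, ?_, fun l hl hlj => ?_⟩, ?_⟩
  · rcases h4.eq_or_lt with h7 | h7
    · subst h7
      omega
    · have := h1 i h7 h5
      omega
  · have := h1 l (by omega) hlj
    have := h.gap.le_of_between l hl hlj
    omega
  · have h7 := prefixSum_raiseAt hk x j j i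
    rw [sub_self, Int.zero_ediv, ediv_eq_neg_one (a := i - j) hk (by omega) (by omega)] at h7
    omega

/-- After raising at the right end `j` of a widest gap, all arcs that do not end at `j` are
lighter than the new one: they lie within the old gaps. -/
theorem IsWidestGap.weight_le {m x : ℤ → ℤ} {k : ℤ} (hk : 0 < k) (hm : ∀ i, m (i + k) = m i)
    (hx : ∀ i, x (i + k) = x i) (hx0 : ∀ i, 0 ≤ x i)
    (hu : 2 ≤ prefixSum m k - 2 * prefixSum x k) {i j : ℤ}
    (h : IsWidestGap m x i j) {p l : ℤ} (hl : ¬ k ∣ l - j)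
    (ha : IsArc (valley m (raiseAt k x j)) p l) :
    prefixSum (raiseAt k x j) l - prefixSum (raiseAt k x j) p ≤
      prefixSum x j - prefixSum x i := by
  have hV := valley_add_period hm hx
  have hV' := valley_add_period hm (raiseAt_add_period hx j)
  -- by periodicity, `l` may be moved into the window between `j - k` and `j`
  wlog hw : j - k < l ∧ l < j generalizing p l
  · obtain ⟨l', t, h1, h2, h3, -⟩ := exists_window hk (j - k) l
    have h4 : l' ≠ j := by
      rintro rfl
      exact hl ⟨t, by rw [h3]; ring⟩
    have h5 := this (p := p + (-t) * k) (l := l + (-t) * k)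
      (by rwa [show l + -t * k - j = l - j + k * (-t) by ring, dvd_add_left (dvd_mul_right _ _)])
      (ha.add_mul hV' _) ⟨by linarith, by
        have : l + -t * k = l' := by linarith
        omega⟩
    rwa [apply_add_mul_period (prefixSum_add_period (raiseAt_add_period hx j)),
      apply_add_mul_period (prefixSum_add_period (raiseAt_add_period hx j)),
      add_sub_add_right_eq_sub] at h5
  obtain ⟨hl1, hl2⟩ := hw
  have hjk := hV (j - k)
  rw [sub_add_cancel] at hjk
  obtain ⟨c, h1, h2, h3⟩ := valley_raiseAt hk m x j
  -- `q` is the first record from `l` on, `(p', q)` the gap around `l`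
  obtain ⟨q, ⟨hq1, hq2⟩, hq3⟩ := Int.exists_least_of_bdd
    (P := fun q => l ≤ q ∧ ∀ l, q < l → valley m x q < valley m x l)
    ⟨l, fun z hz => hz.1⟩ ⟨j, hl2.le, h.gap.lt_of_gt⟩
  have hqj : q ≤ j := hq3 j ⟨hl2.le, h.gap.lt_of_gt⟩
  obtain ⟨p', hp'⟩ := IsGap.exists_of_record hk (by omega) hV hq2
  have hp1 : p' < l := by
    by_contra! hcon
    have := hq3 p' ⟨hcon, hp'.record_left⟩
    have := hp'.lt
    omega
  have hrec : ∀ l, j - k < l → valley m x (j - k) < valley m x l := by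
    intro l hl
    have h4 := h.gap.lt_of_gt (l + k) (by omega)
    rw [hV] at h4
    omega
  have hp2 : j - k ≤ p' := by
    by_contra! hcon
    have := hp'.le_of_between (j - k) hcon (by omega)
    have := hrec q (by omega)
    omega
  have hp3 : p' ≤ p := by
    by_contra! hcon
    have h4 := ha.lt_of_between p' hcon hp1
    have h5 := hp'.record_left l hp1
    have h6 := h1 l hl1 hl2
    rcases hp2.eq_or_lt with h7 | h7
    · subst h7
      omega
    · have := h1 p' h7 (by omega)
      omega
  have h4 := ha.lt
  have h5 := prefixSum_raiseAt hk x j l p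
  rw [ediv_eq_neg_one (a := l - j) hk (by omega) (by omega),
    ediv_eq_neg_one (a := p - j) hk (by omega) (by omega)] at h5
  have h6 := prefixSum_mono hx0 hq1
  have h7 := prefixSum_mono hx0 hp3
  have h8 := h.max _ _ hp'
  omega

/-- The position of the last raise can be recovered, up to the period: it is the end of the
heaviest arc. -/
theorem IsWidestGap.dvd_sub_of_raiseAt_eq {m x₁ x₂ : ℤ → ℤ} {k : ℤ} (hk : 0 < k)
    (hm : ∀ i, m (i + k) = m i)
    (hx₁ : ∀ i, x₁ (i + k) = x₁ i) (hx₁' : ∀ i, 0 ≤ x₁ i)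
    (hu₁ : 2 ≤ prefixSum m k - 2 * prefixSum x₁ k)
    (hx₂ : ∀ i, x₂ (i + k) = x₂ i) (hx₂' : ∀ i, 0 ≤ x₂ i)
    (hu₂ : 2 ≤ prefixSum m k - 2 * prefixSum x₂ k) {i₁ j₁ i₂ j₂ : ℤ}
    (h₁ : IsWidestGap m x₁ i₁ j₁) (h₂ : IsWidestGap m x₂ i₂ j₂)
    (heq : raiseAt k x₁ j₁ = raiseAt k x₂ j₂) : k ∣ j₂ - j₁ := by
  by_contra hcon
  obtain ⟨a₁, w₁⟩ := h₁.isArc_raiseAt hk hm hx₁ hu₁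
  obtain ⟨a₂, w₂⟩ := h₂.isArc_raiseAt hk hm hx₂ hu₂
  have b₁ := h₁.weight_le hk hm hx₁ hx₁' hu₁ hcon (by rw [heq]; exact a₂)
  have b₂ := h₂.weight_le hk hm hx₂ hx₂' hu₂ (by rwa [← dvd_neg, neg_sub])
    (by rw [← heq]; exact a₁)
  rw [heq] at b₁ w₁
  omega

end Valleys

/-! ### The mirror image of a cyclic bracket word -/

section Mirror

/-- The minimum of `V` over all indices after `i`; a junk value unless `V` is bounded below there,
as it is for periodic words in the lower half. -/
noncomputable def futureMin (V : ℤ → ℤ) (i : ℤ) : ℤ := sInf (V '' Set.Ioi i)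

/-- The mirror image of `x`: in each block, all unmatched up steps become down steps. -/
noncomputable def mirror (m x : ℤ → ℤ) (i : ℤ) : ℤ :=
  x i + futureMin (valley m x) i - futureMin (valley m x) (i - 1)

theorem futureMin_eq {V : ℤ → ℤ} {i l : ℤ} (hl : i < l) (h : ∀ l', i < l' → V l ≤ V l') :
    futureMin V i = V l :=
  IsLeast.csInf_eq ⟨⟨l, hl, rfl⟩, by rintro _ ⟨l', hl', rfl⟩; exact h l' hl'⟩

section

variable {V : ℤ → ℤ} {k u : ℤ} (hk : 0 < k) (hu : 0 ≤ u) (hV : ∀ i, V (i + k) = V i + u)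
include hk hu hV

theorem exists_eq_futureMin (i : ℤ) : ∃ l, i < l ∧ futureMin V i = V l := by
  obtain ⟨l, h1, h2⟩ := exists_forall_gt_le hk hu hV i
  exact ⟨l, h1, futureMin_eq h1 h2⟩

theorem futureMin_le {i l : ℤ} (hl : i < l) : futureMin V i ≤ V l := by
  obtain ⟨l', h1, h2⟩ := exists_forall_gt_le hk hu hV i
  rw [futureMin_eq h1 h2]
  exact h2 l hl

theorem le_futureMin {i B : ℤ} (h : ∀ l, i < l → B ≤ V l) : B ≤ futureMin V i := by
  obtain ⟨l', h1, h2⟩ := exists_eq_futureMin hk hu hV i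
  rw [h2]
  exact h l' h1

theorem futureMin_mono : Monotone (futureMin V) := fun _ _ hij =>
  le_futureMin hk hu hV fun _ hl => futureMin_le hk hu hV (hij.trans_lt hl)

theorem futureMin_sub_one (i : ℤ) : futureMin V (i - 1) = min (V i) (futureMin V i) := by
  apply le_antisymm
  · exact le_min (futureMin_le hk hu hV (by omega)) (futureMin_mono hk hu hV (by omega))
  · refine le_futureMin hk hu hV fun l hl => ?_
    rcases (show i ≤ l by omega).eq_or_lt with rfl | h
    · exact min_le_left _ _
    · exact (min_le_right _ _).trans (futureMin_le hk hu hV h)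

theorem futureMin_add_period (i : ℤ) : futureMin V (i + k) = futureMin V i + u := by
  obtain ⟨l, h1, h2⟩ := exists_forall_gt_le hk hu hV i
  rw [futureMin_eq h1 h2, ← hV]
  refine futureMin_eq (by omega) fun l' hl' => ?_
  have h3 := h2 (l' - k) (by omega)
  have h4 := hV (l' - k)
  rw [sub_add_cancel] at h4
  rw [hV]
  omega

end

theorem prefixSum_mirror (m x : ℤ → ℤ) (i : ℤ) :
    prefixSum (mirror m x) i =
      prefixSum x i + futureMin (valley m x) i - futureMin (valley m x) 0 := by
  have h := sub_eq_sub_of_increment_eq (f := prefixSum (mirror m x))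
    (g := fun i => prefixSum x i + futureMin (valley m x) i) (fun i => by
      rw [prefixSum_add_one, prefixSum_add_one, mirror, add_sub_cancel_right]
      omega) i 0
  simp only [prefixSum_zero] at h
  omega

section

variable {m x : ℤ → ℤ} {k : ℤ} (hk : 0 < k) (hm : ∀ i, m (i + k) = m i)
  (hx : ∀ i, x (i + k) = x i) (hu : 0 ≤ prefixSum m k - 2 * prefixSum x k)
include hk hm hx hu

theorem mirror_add_period (i : ℤ) : mirror m x (i + k) = mirror m x i := by
  have hV := valley_add_period hm hx
  rw [mirror, hx, show i + k - 1 = i - 1 + k by ring, futureMin_add_period hk hu hV,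
    futureMin_add_period hk hu hV, mirror]
  ring

theorem prefixSum_mirror_period :
    prefixSum (mirror m x) k = prefixSum m k - prefixSum x k := by
  have h := futureMin_add_period hk hu (valley_add_period hm hx) 0
  rw [zero_add] at h
  rw [prefixSum_mirror, h]
  ring

theorem le_mirror (i : ℤ) : x i ≤ mirror m x i := by
  have := futureMin_mono hk hu (valley_add_period hm hx) (show i - 1 ≤ i by omega)
  unfold mirror
  omega

theorem mirror_le (hx0 : ∀ i, 0 ≤ x i) (hxm : ∀ i, x i ≤ m i) (i : ℤ) :
    mirror m x i ≤ m i := by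
  have h1 := futureMin_sub_one hk hu (valley_add_period hm hx) i
  have h2 := futureMin_le hk hu (valley_add_period hm hx) (show i < i + 1 by omega)
  have h3 := valley_add_one m x i
  have h4 := hxm i
  have h5 := hx0 (i + 1)
  unfold mirror
  omega

/-- The valleys of `x` are, up to a constant, recovered from those of its mirror image by taking
minima over the past. -/
theorem isLeast_valley_mirror (i : ℤ) :
    IsLeast (valley m (mirror m x) '' Set.Iic i)
      (2 * futureMin (valley m x) 0 - futureMin (valley m x) i) := by
  have hV := valley_add_period hm hx
  have key : ∀ l, valley m (mirror m x) l = 2 * futureMin (valley m x) 0 +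
      (valley m x l - futureMin (valley m x) l - futureMin (valley m x) (l - 1)) := by
    intro l
    rw [valley, prefixSum_mirror, prefixSum_mirror, valley]
    ring
  constructor
  · obtain ⟨l₀, h1, h2⟩ := exists_eq_futureMin hk hu hV i
    obtain ⟨l₁, t, h3, h4, h5, h6⟩ := exists_window hk (i - k) l₀
    have h7 := apply_add_mul_period hV l₁ t
    have h8 := mul_nonneg (h6 (by omega)) hu
    rw [← h5] at h7
    -- the minimum is attained at the last block up to `i` whose valley is not above the future
    obtain ⟨l, ⟨h9, h10⟩, h11⟩ := Int.exists_greatest_of_bdd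
      (P := fun l => l ≤ i ∧ valley m x l ≤ futureMin (valley m x) i) ⟨i, fun z hz => hz.1⟩
      ⟨l₁, by omega, by omega⟩
    have h12 : futureMin (valley m x) i ≤ futureMin (valley m x) l := by
      refine le_futureMin hk hu hV fun l' hl' => ?_
      rcases le_or_gt l' i with h | h
      · by_contra! hcon
        have := h11 l' ⟨h, hcon.le⟩
        omega
      · exact futureMin_le hk hu hV h
    have h13 := futureMin_mono hk hu hV h9
    have h14 := futureMin_sub_one hk hu hV l
    have h15 := key l
    exact ⟨l, h9, by omega⟩
  · rintro _ ⟨l, hl, rfl⟩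
    have h1 := futureMin_mono hk hu hV hl
    have h2 := futureMin_sub_one hk hu hV l
    have h3 := key l
    omega

theorem mirror_eq_self (hu0 : prefixSum m k - 2 * prefixSum x k = 0) : mirror m x = x := by
  have hV := valley_add_period hm hx
  funext i
  have h1 := futureMin_mono hk hu hV (show i - 1 ≤ i by omega)
  have h2 := futureMin_mono hk hu hV (show i ≤ i - 1 + k by omega)
  rw [futureMin_add_period hk hu hV, hu0] at h2
  unfold mirror
  omega

end

theorem mirror_injective {m x₁ x₂ : ℤ → ℤ} {k : ℤ} (hk : 0 < k) (hm : ∀ i, m (i + k) = m i)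
    (hx₁ : ∀ i, x₁ (i + k) = x₁ i) (hu₁ : 0 ≤ prefixSum m k - 2 * prefixSum x₁ k)
    (hx₂ : ∀ i, x₂ (i + k) = x₂ i) (hu₂ : 0 ≤ prefixSum m k - 2 * prefixSum x₂ k)
    (h : mirror m x₁ = mirror m x₂) : x₁ = x₂ := by
  have key : ∀ i, 2 * futureMin (valley m x₁) 0 - futureMin (valley m x₁) i =
      2 * futureMin (valley m x₂) 0 - futureMin (valley m x₂) i := fun i => by
    have h1 := isLeast_valley_mirror hk hm hx₁ hu₁ i
    rw [h] at h1
    exact h1.unique (isLeast_valley_mirror hk hm hx₂ hu₂ i)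
  funext i
  have h1 := key i
  have h2 := key (i - 1)
  have h3 := congrFun h i
  unfold mirror at h3
  omega

/-- Raising at the right end of a gap matches one more pair of steps, and so takes the unmatched
up step at the left end of the gap away from the mirror image. -/
theorem mirror_raiseAt_le {m x : ℤ → ℤ} {k : ℤ} (hk : 0 < k) (hm : ∀ i, m (i + k) = m i)
    (hx : ∀ i, x (i + k) = x i) (hu : 2 ≤ prefixSum m k - 2 * prefixSum x k) {i j : ℤ}
    (h : IsGap (valley m x) i j) (l : ℤ) : mirror m (raiseAt k x j) l ≤ mirror m x l := by
  have hx' := raiseAt_add_period hx j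
  have hu' : 0 ≤ prefixSum m k - 2 * prefixSum (raiseAt k x j) k := by
    rw [prefixSum_raiseAt_period hk]
    omega
  have hu0 : 0 ≤ prefixSum m k - 2 * prefixSum x k := by omega
  have hV := valley_add_period hm hx
  have hV' := valley_add_period hm hx'
  -- both sides are periodic
  wlog hw : j - k < l ∧ l ≤ j generalizing l
  · obtain ⟨l', t, h1, h2, rfl, -⟩ := exists_window hk (j - k) l
    have h3 := this l' ⟨h1, by omega⟩
    have h4 := apply_add_mul_period (V := mirror m x) (k := k) (u := 0)
      (fun i => by rw [add_zero, mirror_add_period hk hm hx hu0]) l' t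
    have h5 := apply_add_mul_period (V := mirror m (raiseAt k x j)) (k := k) (u := 0)
      (fun i => by rw [add_zero, mirror_add_period hk hm hx' hu']) l' t
    rwa [h4, h5, mul_zero, add_zero, add_zero]
  obtain ⟨hl1, hl2⟩ := hw
  obtain ⟨c, h1, h2, h3⟩ := valley_raiseAt hk m x j
  have hjk := h.sub_period_le hk (by omega) hV
  have hij := h.lt
  have hval := h.val_lt
  have hper := prefixSum_raiseAt_period hk x j
  -- the future minimum drops by one from `i` to `j - 1`, and is unchanged from `j - k` to `i - 1`
  have tail : ∀ l, j - 1 < l → valley m (raiseAt k x j) j ≤ valley m (raiseAt k x j) l :=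
    le_of_forall_window hk hu' hV' fun l hl hl' => by
      rcases (show j ≤ l by omega).eq_or_lt with rfl | h4
      · exact le_rfl
      · have h5 := hV' (l - k)
        have h6 := h1 (l - k) (by omega) (by omega)
        have h7 := hV (l - k)
        have h8 := h.lt_of_gt l h4
        rw [sub_add_cancel] at h5 h7
        omega
  have right : ∀ l, i ≤ l → l < j →
      futureMin (valley m (raiseAt k x j)) l = futureMin (valley m x) l + c - 1 := by
    intro l hil hlj
    rw [futureMin_eq (V := valley m x) (l := j) hlj, futureMin_eq (l := j) hlj, h2]
    · intro l' hl'
      rcases lt_or_ge l' j with h4 | h4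
      · have h5 := h1 l' (by omega) h4
        have h6 := h.le_of_between l' (by omega) h4
        omega
      · exact tail l' (by omega)
    · intro l' hl'
      rcases lt_trichotomy l' j with h4 | rfl | h4
      · exact h.le_of_between l' (by omega) h4
      · exact le_rfl
      · exact (h.lt_of_gt l' h4).le
  have left : ∀ l, j - k ≤ l → l < i →
      futureMin (valley m (raiseAt k x j)) l = futureMin (valley m x) l + c := by
    intro l hjl hli
    obtain ⟨l₀, h4, h5⟩ := exists_eq_futureMin hk hu0 hV l
    have h6 := futureMin_le hk hu0 hV hli
    have h7 : l₀ < j := by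
      by_contra! hcon
      rcases hcon.eq_or_lt with rfl | h7
      · omega
      · have := h.lt_of_gt l₀ h7
        omega
    have h8 := h1 l₀ (by omega) h7
    rw [h5, ← h8]
    refine futureMin_eq h4 fun l' hl' => ?_
    rcases lt_or_ge l' j with h9 | h9
    · have h10 := h1 l' (by omega) h9
      have h11 := futureMin_le hk hu0 hV hl'
      omega
    · have := tail l' (by omega)
      omega
  have both : ∀ l, j - k ≤ l → l < j →
      futureMin (valley m (raiseAt k x j)) l =
        futureMin (valley m x) l + c - if i ≤ l then 1 else 0 := by
    intro l h4 h5
    split_ifs with h6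
    · exact right l h6 h5
    · rw [left l h4 (by omega), sub_zero]
  have hr : raiseAt k x j l = x l + if k ∣ l - j then 1 else 0 := rfl
  unfold mirror
  rcases hl2.eq_or_lt with rfl | hlj
  · have h4 := both (l - 1) (by omega) (by omega)
    have h5 := both (l - k) le_rfl (by omega)
    have h6 := futureMin_add_period hk hu' hV' (l - k)
    have h7 := futureMin_add_period hk hu0 hV (l - k)
    rw [sub_add_cancel] at h6 h7
    rw [if_pos (by omega)] at h4
    rw [if_pos (by simp)] at hr
    split_ifs at h5 <;> omega
  · have h4 := both (l - 1) (by omega) (by omega)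
    have h5 := both l (by omega) (by omega)
    have h6 : ¬ k ∣ l - j := fun hd => by
      have : k ≤ j - l := Int.le_of_dvd (by omega) (by rwa [← dvd_neg, neg_sub])
      omega
    rw [if_neg h6] at hr
    split_ifs at h4 h5 <;> omega

end Mirror

/-! ### Shifting the sequences -/

section Shift

theorem prefixSum_shift (x : ℤ → ℤ) (s i : ℤ) :
    prefixSum (fun l => x (l + s)) i = prefixSum x (i + s) - prefixSum x s := by
  have h := sub_eq_sub_of_increment_eq (f := prefixSum fun l => x (l + s))
    (g := fun i => prefixSum x (i + s)) (fun i => by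
      have h1 := prefixSum_add_one x (i + s)
      rw [prefixSum_add_one, show i + 1 + s = i + s + 1 by ring]
      omega) i 0
  simpa only [prefixSum_zero, zero_add, sub_zero] using h

theorem valley_shift (m x : ℤ → ℤ) (s : ℤ) :
    ∃ c, ∀ i, valley (fun l => m (l + s)) (fun l => x (l + s)) i = valley m x (i + s) + c := by
  refine ⟨-prefixSum m s + 2 * prefixSum x s, fun i => ?_⟩
  simp only [valley, prefixSum_shift]
  rw [show i - 1 + s = i + s - 1 by ring]
  ring

theorem raiseAt_shift (k : ℤ) (x : ℤ → ℤ) (s j i : ℤ) :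
    raiseAt k (fun l => x (l + s)) (j - s) i = raiseAt k x j (i + s) := by
  simp only [raiseAt, show i + s - j = i - (j - s) by ring]

theorem IsWidestGap.shift {m x : ℤ → ℤ} {i j : ℤ} (h : IsWidestGap m x i j) (s : ℤ) :
    IsWidestGap (fun l => m (l + s)) (fun l => x (l + s)) (i - s) (j - s) := by
  obtain ⟨c, hc⟩ := valley_shift m x s
  refine ⟨⟨by linarith [h.gap.lt], ?_, fun l h1 h2 => ?_, fun l h1 => ?_⟩, fun i' j' h' => ?_⟩
  · rw [hc, hc, sub_add_cancel, sub_add_cancel]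
    linarith [h.gap.val_lt]
  · rw [hc, hc, sub_add_cancel]
    linarith [h.gap.le_of_between (l + s) (by linarith) (by linarith)]
  · rw [hc, hc, sub_add_cancel]
    linarith [h.gap.lt_of_gt (l + s) (by linarith)]
  · have h1 : IsGap (valley m x) (i' + s) (j' + s) := by
      refine ⟨by linarith [h'.lt], ?_, fun l h1 h2 => ?_, fun l h1 => ?_⟩
      · have := h'.val_lt
        rw [hc, hc] at this
        linarith
      · have := h'.le_of_between (l - s) (by linarith) (by linarith)
        rw [hc, hc, sub_add_cancel] at this
        linarith
      · have := h'.lt_of_gt (l - s) (by linarith)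
        rw [hc, hc, sub_add_cancel] at this
        linarith
    have h2 := h.max _ _ h1
    simp only [prefixSum_shift, sub_add_cancel]
    linarith

theorem mirror_shift {m x : ℤ → ℤ} {k : ℤ} (hk : 0 < k) (hm : ∀ i, m (i + k) = m i)
    (hx : ∀ i, x (i + k) = x i) (hu : 0 ≤ prefixSum m k - 2 * prefixSum x k) (s i : ℤ) :
    mirror (fun l => m (l + s)) (fun l => x (l + s)) i = mirror m x (i + s) := by
  obtain ⟨c, hc⟩ := valley_shift m x s
  have key : ∀ i, futureMin (valley (fun l => m (l + s)) (fun l => x (l + s))) i =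
      futureMin (valley m x) (i + s) + c := by
    intro i
    obtain ⟨l, h1, h2⟩ := exists_forall_gt_le hk hu (valley_add_period hm hx) (i + s)
    have h3 := hc (l - s)
    rw [sub_add_cancel] at h3
    rw [futureMin_eq h1 h2, ← h3]
    refine futureMin_eq (by linarith) fun l' hl' => ?_
    rw [h3, hc]
    linarith [h2 (l' + s) (by linarith)]
  simp only [mirror, key]
  rw [show i - 1 + s = i + s - 1 by ring]
  ring

theorem IsGap.lt_up {m x : ℤ → ℤ} (hx0 : ∀ i, 0 ≤ x i) {i j : ℤ} (h : IsGap (valley m x) i j) :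
    x j < m j := by
  have h1 := h.lt_of_gt (j + 1) (by omega)
  have h2 := valley_add_one m x j
  have h3 := hx0 (j + 1)
  omega

end Shift

/-! ### Symmetric chain decompositions modulo an equivalence -/

section ChainData

/-- A symmetric chain decomposition of the quotient of `X` by the equivalence relation `E`, in
terms of representatives: a family of chains, the chain `i` having one element `c i k` in each
rank `k` from `a i` to `N - a i` (the values of `c i` at other ranks are irrelevant). The relation
`R` stands for the order of the quotient. -/
structure SymmChainData {X : Type u} (R E : X → X → Prop) (ρ : X → ℕ) (N : ℕ) where
  ι : Type u
  a : ι → ℕ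
  c : ι → ℕ → X
  two_mul_le : ∀ i, 2 * a i ≤ N
  rank_eq : ∀ i k, a i ≤ k → k + a i ≤ N → ρ (c i k) = k
  rel : ∀ i k, a i ≤ k → k + 1 + a i ≤ N → R (c i k) (c i (k + 1))
  exists_mem : ∀ x, ∃ i, a i ≤ ρ x ∧ ρ x + a i ≤ N ∧ E (c i (ρ x)) x
  unique : ∀ i j k, a i ≤ k → k + a i ≤ N → a j ≤ k → k + a j ≤ N → E (c i k) (c j k) → i = j

/-- Transport along a map that induces a bijection of the quotients. -/
def SymmChainData.map {A B : Type u} {RA EA : A → A → Prop} {ρA : A → ℕ} {RB EB : B → B → Prop}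
    {ρB : B → ℕ} {N : ℕ} (D : SymmChainData RA EA ρA N) (φ : A → B)
    (hρ : ∀ x, ρB (φ x) = ρA x) (hR : ∀ x y, RA x y → RB (φ x) (φ y))
    (hsurj : ∀ y, ∃ x, ρA x = ρB y ∧ ∀ x', EA x' x → EB (φ x') y)
    (hinj : ∀ x y, EB (φ x) (φ y) → EA x y) : SymmChainData RB EB ρB N where
  ι := D.ι
  a := D.a
  c i k := φ (D.c i k)
  two_mul_le := D.two_mul_le
  rank_eq i k h1 h2 := by rw [hρ, D.rank_eq i k h1 h2]
  rel i k h1 h2 := hR _ _ (D.rel i k h1 h2)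
  exists_mem y := by
    obtain ⟨x, h1, h2⟩ := hsurj y
    obtain ⟨i, h3, h4, h5⟩ := D.exists_mem x
    exact ⟨i, by omega, by omega, by rw [← h1]; exact h2 _ h5⟩
  unique i j k h1 h2 h3 h4 h5 := D.unique i j k h1 h2 h3 h4 (hinj _ _ h5)

/-- The product of two symmetric chain decompositions: a rectangle of side lengths `p` and `q` is
the disjoint union of the hooks `(0, t), …, (p - t, t), …, (p - t, q)`, for `t ≤ min p q`. -/
def SymmChainData.prod {X Y : Type u} {R₁ E₁ : X → X → Prop} {ρ₁ : X → ℕ} {N₁ : ℕ}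
    {R₂ E₂ : Y → Y → Prop} {ρ₂ : Y → ℕ} {N₂ : ℕ}
    (D₁ : SymmChainData R₁ E₁ ρ₁ N₁) (D₂ : SymmChainData R₂ E₂ ρ₂ N₂)
    (hR₁ : ∀ x, R₁ x x) (hR₂ : ∀ x, R₂ x x) (hE₁ : ∀ x y, E₁ x y → ρ₁ x = ρ₁ y) :
    SymmChainData (X := X × Y) (fun p q => R₁ p.1 q.1 ∧ R₂ p.2 q.2)
      (fun p q => E₁ p.1 q.1 ∧ E₂ p.2 q.2) (fun p => ρ₁ p.1 + ρ₂ p.2) (N₁ + N₂) where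
  ι := {s : D₁.ι × D₂.ι × ℕ // s.2.2 + 2 * D₁.a s.1 ≤ N₁ ∧ s.2.2 + 2 * D₂.a s.2.1 ≤ N₂}
  a s := D₁.a s.1.1 + D₂.a s.1.2.1 + s.1.2.2
  c s k :=
    let f := min (k - (D₂.a s.1.2.1 + s.1.2.2)) (N₁ - D₁.a s.1.1 - s.1.2.2)
    (D₁.c s.1.1 f, D₂.c s.1.2.1 (k - f))
  two_mul_le := by
    rintro ⟨⟨i, j, t⟩, h⟩
    obtain ⟨h1, h2⟩ := id h
    dsimp only at h1 h2 ⊢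
    omega
  rank_eq := by
    rintro ⟨⟨i, j, t⟩, h⟩ k h3 h4
    obtain ⟨h1, h2⟩ := id h
    dsimp only at h1 h2 h3 h4 ⊢
    rw [D₁.rank_eq _ _ (by omega) (by omega), D₂.rank_eq _ _ (by omega) (by omega)]
    omega
  rel := by
    rintro ⟨⟨i, j, t⟩, h⟩ k h3 h4
    obtain ⟨h1, h2⟩ := id h
    dsimp only at h1 h2 h3 h4 ⊢
    rcases lt_or_ge (k - (D₂.a j + t)) (N₁ - D₁.a i - t) with h | h
    · rw [min_eq_left (by omega), min_eq_left (by omega),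
        show k + 1 - (D₂.a j + t) = k - (D₂.a j + t) + 1 by omega,
        show k + 1 - (k - (D₂.a j + t) + 1) = k - (k - (D₂.a j + t)) by omega]
      exact ⟨D₁.rel _ _ (by omega) (by omega), hR₂ _⟩
    · rw [min_eq_right h, min_eq_right (by omega),
        show k + 1 - (N₁ - D₁.a i - t) = k - (N₁ - D₁.a i - t) + 1 by omega]
      exact ⟨hR₁ _, D₂.rel _ _ (by omega) (by omega)⟩
  exists_mem := by
    rintro ⟨x, y⟩
    obtain ⟨i, h1, h2, h3⟩ := D₁.exists_mem x
    obtain ⟨j, h4, h5, h6⟩ := D₂.exists_mem y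
    have h7 := D₁.two_mul_le i
    have h8 := D₂.two_mul_le j
    refine ⟨⟨(i, j, min (ρ₂ y - D₂.a j) (N₁ - D₁.a i - ρ₁ x)), ?_, ?_⟩, ?_, ?_, ?_⟩
    · dsimp only
      omega
    · dsimp only
      omega
    · dsimp only
      omega
    · dsimp only
      omega
    · dsimp only
      rw [show min (ρ₁ x + ρ₂ y - (D₂.a j + min (ρ₂ y - D₂.a j) (N₁ - D₁.a i - ρ₁ x)))
        (N₁ - D₁.a i - min (ρ₂ y - D₂.a j) (N₁ - D₁.a i - ρ₁ x)) = ρ₁ x by omega,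
        add_tsub_cancel_left]
      exact ⟨h3, h6⟩
  unique := by
    rintro ⟨⟨i, j, t⟩, h⟩ ⟨⟨i', j', t'⟩, h'⟩ k h3 h4 h5 h6 ⟨h7, h8⟩
    obtain ⟨h1, h2⟩ := id h
    obtain ⟨h1', h2'⟩ := id h'
    dsimp only at h1 h2 h1' h2' h3 h4 h5 h6 h7 h8 ⊢
    have h9 := hE₁ _ _ h7
    rw [D₁.rank_eq _ _ (by omega) (by omega), D₁.rank_eq _ _ (by omega) (by omega)] at h9
    rw [← h9] at h7 h8
    obtain rfl := D₁.unique i i' _ (by omega) (by omega) (by omega) (by omega) h7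
    obtain rfl := D₂.unique j j' _ (by omega) (by omega) (by omega) (by omega) h8
    obtain rfl : t = t' := by omega
    rfl

/-- Products of finitely many symmetric chain decompositions; only the coordinates in `s` are
taken into account. -/
theorem SymmChainData.nonempty_pi {C : Type} [DecidableEq C] {X : C → Type u}
    [∀ c, Nonempty (X c)] {R E : ∀ c, X c → X c → Prop} {ρ : ∀ c, X c → ℕ} {N : C → ℕ}
    (D : ∀ c, SymmChainData (R c) (E c) (ρ c) (N c)) (hR : ∀ c x, R c x x)
    (hE : ∀ c x y, E c x y → ρ c x = ρ c y) (s : Finset C) :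
    Nonempty (SymmChainData (X := ∀ c, X c) (fun x y => ∀ c ∈ s, R c (x c) (y c))
      (fun x y => ∀ c ∈ s, E c (x c) (y c)) (fun x => ∑ c ∈ s, ρ c (x c)) (∑ c ∈ s, N c)) := by
  induction s using Finset.induction_on with
  | empty =>
    exact ⟨{
      ι := PUnit
      a := fun _ => 0
      c := fun _ _ => Classical.arbitrary _
      two_mul_le := by simp
      rank_eq := by simp
      rel := by simp
      exists_mem := by simp
      unique := by simp }⟩
  | insert b s hb ih =>
    obtain ⟨Ds⟩ := ih
    have hne : ∀ c ∈ s, c ≠ b := fun c hc h => hb (h ▸ hc)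
    rw [Finset.sum_insert hb, add_comm]
    refine ⟨(Ds.prod (D b) (fun x c _ => hR c _) (hR b)
      (fun x y h => Finset.sum_congr rfl fun c hc => hE c _ _ (h c hc))).map
      (fun p => Function.update p.1 b p.2) ?_ ?_ ?_ ?_⟩
    · rintro ⟨x, y⟩
      rw [Finset.sum_insert hb, add_comm, Function.update_self]
      congr 1
      exact Finset.sum_congr rfl fun c hc => by rw [Function.update_of_ne (hne c hc)]
    · rintro ⟨x, y⟩ ⟨x', y'⟩ ⟨h1, h2⟩ c hc
      rcases Finset.mem_insert.1 hc with rfl | hc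
      · simpa using h2
      · dsimp only
        rw [Function.update_of_ne (hne c hc), Function.update_of_ne (hne c hc)]
        exact h1 c hc
    · intro y
      refine ⟨(y, y b), by rw [Finset.sum_insert hb, add_comm], ?_⟩
      rintro ⟨x, y'⟩ ⟨h1, h2⟩ c hc
      rcases Finset.mem_insert.1 hc with rfl | hc
      · simpa using h2
      · dsimp only
        rw [Function.update_of_ne (hne c hc)]
        exact h1 c hc
    · rintro ⟨x, y⟩ ⟨x', y'⟩ h
      refine ⟨fun c hc => ?_, ?_⟩
      · have := h c (Finset.mem_insert_of_mem hc)
        dsimp only at this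
        rwa [Function.update_of_ne (hne c hc), Function.update_of_ne (hne c hc)] at this
      · simpa using h b (Finset.mem_insert_self _ _)

section Raise

variable {Q : Type u} {ρ : Q → ℕ} {N : ℕ} {up : Q → Q}

theorem rank_iterate_up (hup : ∀ x, 2 * ρ x + 2 ≤ N → ρ (up x) = ρ x + 1) (x : Q) (t : ℕ)
    (h : 2 * (ρ x + t) ≤ N) : ρ (up^[t] x) = ρ x + t := by
  induction t with
  | zero => rfl
  | succ t ih =>
    have h1 := ih (by omega)
    rw [Function.iterate_succ_apply', hup _ (by omega), h1]
    omega

theorem iterate_up_cancel (hup : ∀ x, 2 * ρ x + 2 ≤ N → ρ (up x) = ρ x + 1)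
    (hinj : ∀ x y, 2 * ρ x + 2 ≤ N → 2 * ρ y + 2 ≤ N → up x = up y → x = y) {x y : Q} {s t : ℕ}
    (hx : 2 * (ρ x + (s + t)) ≤ N) (hy : 2 * (ρ y + t) ≤ N) (h : up^[s + t] x = up^[t] y) :
    up^[s] x = y := by
  induction t with
  | zero => exact h
  | succ t ih =>
    refine ih (by omega) (by omega) (hinj _ _ ?_ ?_ ?_)
    · rw [rank_iterate_up hup] <;> omega
    · rw [rank_iterate_up hup] <;> omega
    · rwa [← add_assoc, Function.iterate_succ_apply', Function.iterate_succ_apply'] at h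

theorem exists_iterate_up_eq (hup : ∀ x, 2 * ρ x + 2 ≤ N → ρ (up x) = ρ x + 1) (z : Q)
    (hz : 2 * ρ z ≤ N) : ∃ x, (2 * ρ x ≤ N ∧ ∀ y, 2 * ρ y + 2 ≤ N → up y ≠ x) ∧ ρ x ≤ ρ z ∧
      up^[ρ z - ρ x] x = z := by
  induction h : ρ z generalizing z with
  | zero =>
    refine ⟨z, ⟨hz, fun y hy hyz => ?_⟩, by omega, by rw [h]; rfl⟩
    have := hup y hy
    rw [hyz] at this
    omega
  | succ n ih =>
    by_cases hc : ∃ y, 2 * ρ y + 2 ≤ N ∧ up y = z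
    · obtain ⟨y, hy, rfl⟩ := hc
      have h1 := hup y hy
      obtain ⟨x, h2, h3, h4⟩ := ih y (by omega) (by omega)
      refine ⟨x, h2, by omega, ?_⟩
      rw [show n + 1 - ρ x = n - ρ x + 1 by omega, Function.iterate_succ_apply', h4]
    · push Not at hc
      exact ⟨z, ⟨hz, hc⟩, by omega, by rw [h, Nat.sub_self]; rfl⟩

/-- A symmetric chain decomposition from an injection `up` that raises the rank by one in the
lower half and a bijection `star` of the lower half with the upper half: the chains climb along
`up` to the middle and go on through the mirror images of their lower parts, in reverse order. -/
def SymmChainData.ofRaise {R : Q → Q → Prop} {star : Q → Q}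
    (hup : ∀ x, 2 * ρ x + 2 ≤ N → ρ (up x) = ρ x + 1)
    (hrel : ∀ x, 2 * ρ x + 2 ≤ N → R x (up x))
    (hinj : ∀ x y, 2 * ρ x + 2 ≤ N → 2 * ρ y + 2 ≤ N → up x = up y → x = y)
    (hstar : ∀ x, 2 * ρ x ≤ N → ρ (star x) + ρ x = N)
    (hstar_inj : ∀ x y, 2 * ρ x ≤ N → 2 * ρ y ≤ N → star x = star y → x = y)
    (hstar_surj : ∀ y, N ≤ 2 * ρ y → ∃ x, 2 * ρ x ≤ N ∧ star x = y)
    (hstar_self : ∀ x, 2 * ρ x = N → star x = x)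
    (hstar_rel : ∀ x, 2 * ρ x + 1 = N → R x (star x))
    (hstar_up : ∀ x, 2 * ρ x + 2 ≤ N → R (star (up x)) (star x)) :
    SymmChainData R Eq ρ N where
  ι := {x : Q // 2 * ρ x ≤ N ∧ ∀ y, 2 * ρ y + 2 ≤ N → up y ≠ x}
  a x := ρ x.1
  c x k := if 2 * k ≤ N then up^[k - ρ x.1] x.1 else star (up^[N - k - ρ x.1] x.1)
  two_mul_le x := x.2.1
  rank_eq := by
    rintro ⟨x, hx'⟩ k h1 h2
    have hx := hx'.1
    dsimp only at h1 h2 ⊢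
    split_ifs with h
    · rw [rank_iterate_up hup] <;> omega
    · have h3 := rank_iterate_up hup x (N - k - ρ x) (by omega)
      have h4 := hstar (up^[N - k - ρ x] x) (by omega)
      omega
  rel := by
    rintro ⟨x, hx'⟩ k h1 h2
    have hx := hx'.1
    dsimp only at h1 h2 ⊢
    rcases lt_trichotomy (2 * k + 1) N with h | h | h
    · rw [if_pos (by omega), if_pos (by omega), show k + 1 - ρ x = k - ρ x + 1 by omega,
        Function.iterate_succ_apply']
      exact hrel _ (by rw [rank_iterate_up hup] <;> omega)
    · rw [if_pos (by omega), if_neg (by omega), show N - (k + 1) - ρ x = k - ρ x by omega]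
      exact hstar_rel _ (by rw [rank_iterate_up hup] <;> omega)
    · have h3 : 2 * ρ (up^[N - (k + 1) - ρ x] x) + 2 ≤ N := by
        rw [rank_iterate_up hup] <;> omega
      have h4 : (if 2 * k ≤ N then up^[k - ρ x] x else star (up^[N - k - ρ x] x)) =
          star (up (up^[N - (k + 1) - ρ x] x)) := by
        rw [← Function.iterate_succ_apply' up, Nat.succ_eq_add_one]
        split_ifs with h4
        · rw [show N - (k + 1) - ρ x + 1 = k - ρ x by omega,
            hstar_self _ (by rw [rank_iterate_up hup] <;> omega)]
        · rw [show N - (k + 1) - ρ x + 1 = N - k - ρ x by omega]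
      rw [h4, if_neg (by omega)]
      exact hstar_up _ h3
  exists_mem z := by
    rcases le_or_gt (2 * ρ z) N with h | h
    · obtain ⟨x, h1, h2, h3⟩ := exists_iterate_up_eq hup z h
      refine ⟨⟨x, h1⟩, h2, by dsimp only; omega, ?_⟩
      dsimp only
      rw [if_pos h, h3]
    · obtain ⟨w, hw, rfl⟩ := hstar_surj z h.le
      have h0 := hstar w hw
      obtain ⟨x, h1, h2, h3⟩ := exists_iterate_up_eq hup w hw
      refine ⟨⟨x, h1⟩, by dsimp only; omega, by dsimp only; omega, ?_⟩
      dsimp only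
      rw [if_neg (by omega), show N - ρ (star w) - ρ x = ρ w - ρ x by omega, h3]
  unique := by
    rintro ⟨x, hx, hx'⟩ ⟨y, hy, hy'⟩ k h1 h2 h3 h4 h5
    dsimp only at h1 h2 h3 h4 h5
    rw [Subtype.mk.injEq]
    obtain ⟨l, hxl, hyl, hl, h6⟩ : ∃ l, ρ x ≤ l ∧ ρ y ≤ l ∧ 2 * l ≤ N ∧
        up^[l - ρ x] x = up^[l - ρ y] y := by
      split_ifs at h5 with h
      · exact ⟨k, h1, h3, h, h5⟩
      · refine ⟨N - k, by omega, by omega, by omega, hstar_inj _ _ ?_ ?_ h5⟩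
        · rw [rank_iterate_up hup] <;> omega
        · rw [rank_iterate_up hup] <;> omega
    clear h5
    wlog hxy : ρ x ≤ ρ y generalizing x y
    · exact (this y hy hy' x hx hx' h3 h4 h1 h2 hyl hxl h6.symm (by omega)).symm
    rw [show l - ρ x = (ρ y - ρ x) + (l - ρ y) by omega] at h6
    have h7 := iterate_up_cancel hup hinj (by omega) (by omega) h6
    rcases h8 : ρ y - ρ x with _ | n
    · rwa [h8] at h7
    · rw [h8, Function.iterate_succ_apply'] at h7
      exact absurd h7 (hy' _ (by rw [rank_iterate_up hup] <;> omega))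

end Raise

end ChainData

/-! ### Graded orders -/

section Graded

/-- `ρ` is the rank function of a finite ordered set with a minimum element, and all maximal
elements have rank `N`. -/
structure IsGraded {X : Type*} [Preorder X] (ρ : X → ℕ) (N : ℕ) : Prop where
  finite : Finite X
  exists_min : ∃ z : X, (∀ x, z ≤ x) ∧ ρ z = 0
  strictMono : StrictMono ρ
  exists_step : ∀ x y, x < y → ∃ z, x < z ∧ z ≤ y ∧ ρ z = ρ x + 1
  exists_top : ∀ x, ∃ y, x ≤ y ∧ ρ y = N

variable {X : Type*} [PartialOrder X]

theorem mem_of_isMaxChain {C : Set X} (hC : IsMaxChain (· ≤ ·) C) {y : X}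
    (h : ∀ c ∈ C, y ≤ c ∨ c ≤ y) : y ∈ C := by
  have h1 : IsChain (· ≤ ·) (insert y C) := hC.isChain.insert fun b hb _ => h b hb
  rw [hC.2 h1 (Set.subset_insert _ _)]
  exact Set.mem_insert _ _

/-- Two maximal chains through `x` may be spliced at `x`. -/
theorem isMaxChain_splice {C D : Set X} (hC : IsMaxChain (· ≤ ·) C) (hD : IsMaxChain (· ≤ ·) D)
    {x : X} (hxC : x ∈ C) (hxD : x ∈ D) :
    IsMaxChain (· ≤ ·) ((C ∩ Set.Iio x) ∪ (D ∩ Set.Ici x)) := by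
  refine ⟨?_, fun t ht hsub => Set.Subset.antisymm hsub fun y hy => ?_⟩
  · rintro a (⟨ha, ha'⟩ | ⟨ha, ha'⟩) b (⟨hb, hb'⟩ | ⟨hb, hb'⟩) hab
    · exact hC.isChain ha hb hab
    · exact Or.inl ((le_of_lt ha').trans hb')
    · exact Or.inr ((le_of_lt hb').trans ha')
    · exact hD.isChain ha hb hab
  · have hxt : x ∈ t := hsub (Or.inr ⟨hxD, le_rfl⟩)
    by_cases hyx : x ≤ y
    · refine Or.inr ⟨mem_of_isMaxChain hD fun d hd => ?_, hyx⟩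
      rcases hD.isChain.total hxD hd with h | h
      · exact ht.total hy (hsub (Or.inr ⟨hd, h⟩))
      · exact Or.inr (h.trans hyx)
    · have hyx' : y < x := ((ht.total hy hxt).resolve_right hyx).lt_of_not_ge hyx
      refine Or.inl ⟨mem_of_isMaxChain hC fun c hc => ?_, hyx'⟩
      by_cases h : x ≤ c
      · exact Or.inl (hyx'.le.trans h)
      · exact ht.total hy (hsub (Or.inl ⟨hc,
          ((hC.isChain.total hc hxC).resolve_right h).lt_of_not_ge h⟩))

theorem IsRanked.ncard_inter_Iio (h : IsRanked X) {C D : Set X} (hC : IsMaxChain (· ≤ ·) C)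
    (hD : IsMaxChain (· ≤ ·) D) {x : X} (hxC : x ∈ C) (hxD : x ∈ D) :
    (C ∩ Set.Iio x).ncard = (D ∩ Set.Iio x).ncard := by
  have := h.finite
  have hdisj : ∀ A : Set X, Disjoint (A ∩ Set.Iio x) (D ∩ Set.Ici x) := fun A =>
    Set.disjoint_left.2 fun a ha hb => absurd hb.2 (not_le_of_gt ha.2)
  have h1 : (D ∩ Set.Iio x) ∪ (D ∩ Set.Ici x) = D := by
    ext d
    constructor
    · rintro (h | h) <;> exact h.1
    · intro hd
      by_cases hxd : x ≤ d
      · exact Or.inr ⟨hd, hxd⟩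
      · exact Or.inl ⟨hd, ((hD.isChain.total hd hxD).resolve_right hxd).lt_of_not_ge hxd⟩
  have h2 := h.card_maxChain _ _ (isMaxChain_splice hC hD hxC hxD) hD
  rw [Set.ncard_union_eq (hdisj C)] at h2
  have h3 := Set.ncard_union_eq (hdisj D)
  rw [h1] at h3
  omega

theorem IsRanked.exists_isGraded (h : IsRanked X) : ∃ (ρ : X → ℕ) (N : ℕ), IsGraded ρ N := by
  have := h.finite
  have hex : ∀ x : X, ∃ C : Set X, IsMaxChain (· ≤ ·) C ∧ x ∈ C := fun x => by
    obtain ⟨C, hC, hx⟩ := (IsChain.singleton (r := (· ≤ ·)) (a := x)).exists_maxChain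
    exact ⟨C, hC, hx rfl⟩
  choose c hc hxc using hex
  have key : ∀ {C : Set X} {x : X}, IsMaxChain (· ≤ ·) C → x ∈ C →
      (c x ∩ Set.Iio x).ncard = (C ∩ Set.Iio x).ncard := fun {C x} hC hx =>
    h.ncard_inter_Iio (hc x) hC (hxc x) hx
  have hpair : ∀ x y : X, x < y → ∃ C : Set X, IsMaxChain (· ≤ ·) C ∧ x ∈ C ∧ y ∈ C := by
    intro x y hxy
    obtain ⟨C, hC, hsub⟩ := (IsChain.pair (r := (· ≤ ·)) hxy.le).exists_maxChain
    exact ⟨C, hC, hsub (by simp), hsub (by simp)⟩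
  obtain ⟨z, hz⟩ := h.exists_min
  refine ⟨fun x => (c x ∩ Set.Iio x).ncard, (c z).ncard - 1, h.finite, ⟨z, hz, ?_⟩, ?_, ?_, ?_⟩
  · rw [Set.ncard_eq_zero]
    exact Set.eq_empty_of_forall_notMem fun x hx => absurd (hz x) (not_le_of_gt hx.2)
  · intro x y hxy
    obtain ⟨C, hC, hx, hy⟩ := hpair x y hxy
    dsimp only
    rw [key hC hx, key hC hy]
    refine Set.ncard_lt_ncard ⟨fun w hw => ⟨hw.1, lt_trans hw.2 hxy⟩, fun hsub => ?_⟩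
    exact lt_irrefl x (hsub ⟨hx, hxy⟩).2
  · intro x y hxy
    obtain ⟨w, hxw, hwy⟩ := exists_covBy_le_of_lt hxy
    refine ⟨w, hxw.lt, hwy, ?_⟩
    obtain ⟨C, hC, hx, hw⟩ := hpair x w hxw.lt
    rw [key hC hx, key hC hw, ← Set.ncard_insert_of_notMem (a := x) fun h => lt_irrefl x h.2]
    congr 1
    ext v
    constructor
    · rintro ⟨hv, hvw⟩
      rcases hC.isChain.total hv hx with h1 | h1
      · rcases h1.eq_or_lt with rfl | h1
        · exact Set.mem_insert _ _
        · exact Set.mem_insert_of_mem _ ⟨hv, h1⟩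
      · rcases h1.eq_or_lt with rfl | h1
        · exact Set.mem_insert _ _
        · exact absurd hvw (hxw.2 h1)
    · rintro (rfl | ⟨hv, hvx⟩)
      · exact ⟨hx, hxw.lt⟩
      · exact ⟨hv, lt_trans hvx hxw.lt⟩
  · intro x
    obtain ⟨y, hy, hmax⟩ := (c x).toFinite.exists_maximalFor id (c x) ⟨x, hxc x⟩
    have hle : ∀ w ∈ c x, w ≤ y := fun w hw => ((hc x).isChain.total hw hy).elim id (hmax hw)
    refine ⟨y, hle x (hxc x), ?_⟩
    rw [key (hc x) hy, h.card_maxChain _ _ (hc z) (hc x), ← Set.ncard_sdiff_singleton_of_mem hy]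
    congr 1
    ext w
    exact ⟨fun hw => ⟨hw.1, ne_of_lt hw.2⟩, fun hw => ⟨hw.1, (hle w hw.1).lt_of_ne hw.2⟩⟩

variable {ρ : X → ℕ} {N : ℕ}

theorem IsGraded.rank_le (h : IsGraded ρ N) (x : X) : ρ x ≤ N := by
  obtain ⟨y, hy, rfl⟩ := h.exists_top x
  exact h.strictMono.monotone hy

theorem IsGraded.covBy (h : IsGraded ρ N) {x y : X} (hxy : x ≤ y) (hr : ρ y = ρ x + 1) :
    x ⋖ y := by
  refine ⟨hxy.lt_of_ne fun he => by rw [he] at hr; omega, fun z hxz hzy => ?_⟩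
  have h1 := h.strictMono hxz
  have h2 := h.strictMono hzy
  omega

theorem IsGraded.rank_eq_of_covBy (h : IsGraded ρ N) {x y : X} (hxy : x ⋖ y) :
    ρ y = ρ x + 1 := by
  obtain ⟨z, hxz, hzy, hz⟩ := h.exists_step x y hxy.lt
  rcases hzy.eq_or_lt with rfl | h1
  · exact hz
  · exact absurd h1 (hxy.2 hxz)

theorem IsGraded.isRanked (h : IsGraded ρ N) : IsRanked X := by
  have := h.finite
  obtain ⟨z, hz, hz0⟩ := h.exists_min
  refine ⟨h.finite, ⟨z, hz⟩, ?_⟩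
  suffices hN : ∀ C : Set X, IsMaxChain (· ≤ ·) C → C.ncard = N + 1 from
    fun C D hC hD => (hN C hC).trans (hN D hD).symm
  intro C hC
  have hinj : Set.InjOn ρ C := fun x hx y hy hxy => by
    by_contra hne
    rcases hC.isChain.total hx hy with h1 | h1
    · exact (h.strictMono (h1.lt_of_ne hne)).ne hxy
    · exact (h.strictMono (h1.lt_of_ne (Ne.symm hne))).ne hxy.symm
  have himg : ρ '' C = Set.Iio (N + 1) := by
    refine Set.Subset.antisymm ?_ fun n hn => ?_
    · rintro _ ⟨x, -, rfl⟩
      exact Nat.lt_succ_of_le (h.rank_le x)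
    · induction n with
      | zero => exact ⟨z, mem_of_isMaxChain hC fun c _ => Or.inl (hz c), hz0⟩
      | succ n ih =>
        have hn' : n + 1 < N + 1 := hn
        obtain ⟨x, hx, hxn⟩ := ih (show n < N + 1 by omega)
        rcases (C ∩ Set.Ioi x).eq_empty_or_nonempty with he | hne
        · obtain ⟨y, hxy, hy⟩ := h.exists_top x
          have hxy' : x < y := hxy.lt_of_ne fun he => by rw [he] at hxn; omega
          have hyC : y ∈ C := mem_of_isMaxChain hC fun c hc => by
            right
            rcases hC.isChain.total hc hx with h1 | h1
            · exact h1.trans hxy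
            · rcases h1.eq_or_lt with rfl | h1
              · exact hxy
              · exact absurd (show c ∈ C ∩ Set.Ioi x from ⟨hc, h1⟩) (by simp [he])
          exact absurd (show y ∈ C ∩ Set.Ioi x from ⟨hyC, hxy'⟩) (by simp [he])
        · obtain ⟨d, ⟨hd, hxd⟩, hmin⟩ :=
            (C ∩ Set.Ioi x).toFinite.exists_minimalFor id _ hne
          obtain ⟨w, hxw, hwd, hw⟩ := h.exists_step x d hxd
          refine ⟨w, mem_of_isMaxChain hC fun c hc => ?_, by rw [hw, hxn]⟩
          by_cases hxc : x < c
          · left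
            exact hwd.trans ((hC.isChain.total hd hc).elim id (hmin ⟨hc, hxc⟩))
          · right
            rcases hC.isChain.total hc hx with h1 | h1
            · exact h1.trans hxw.le
            · rcases h1.eq_or_lt with rfl | h1
              · exact hxw.le
              · exact absurd h1 hxc
  rw [← hinj.ncard_image, himg, ← Finset.coe_Iio, Set.ncard_coe_finset, Nat.card_Iio]

theorem IsGraded.posetRank_eq (h : IsGraded ρ N) (x : X) : posetRank x = ρ x := by
  have := h.finite
  apply le_antisymm
  · have := Order.height_le_height_apply_of_strictMono ρ h.strictMono x
    rwa [Order.height_nat] at this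
  · induction hn : ρ x generalizing x with
    | zero => simp
    | succ n ih =>
      obtain ⟨z, hz, hz0⟩ := h.exists_min
      have hzx : z < x := (hz x).lt_of_ne fun he => by rw [he] at hz0; omega
      obtain ⟨y, -, hyx⟩ := exists_le_covBy_of_lt hzx
      have h1 := h.rank_eq_of_covBy hyx
      have h2 := ih y (by omega)
      push_cast
      exact (add_le_add_left h2 1).trans (Order.height_add_one_le hyx.lt)

theorem IsGraded.totalRank_eq (h : IsGraded ρ N) : totalRank X = N := by
  obtain ⟨z, -, -⟩ := h.exists_min
  obtain ⟨y, -, hy⟩ := h.exists_top z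
  refine le_antisymm (iSup_le fun x => ?_) ?_
  · rw [h.posetRank_eq]
    exact_mod_cast h.rank_le x
  · refine le_iSup_of_le y ?_
    rw [h.posetRank_eq, hy]

theorem rank_add_of_forall_covBy (h : IsGraded ρ N) {k : ℕ} {x : Fin (k + 1) → X}
    (hx : ∀ i : Fin k, x i.castSucc ⋖ x i.succ) (i : Fin (k + 1)) : ρ (x i) = ρ (x 0) + i := by
  induction i using Fin.induction with
  | zero => simp
  | succ i ih =>
    rw [h.rank_eq_of_covBy (hx i), ih]
    simp [add_assoc]

end Graded

/-- A symmetric chain order is a graded order with a symmetric chain decomposition. -/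
theorem isSCO_iff {X : Type u} [PartialOrder X] :
    IsSCO X ↔ ∃ (ρ : X → ℕ) (N : ℕ), IsGraded ρ N ∧
      Nonempty (SymmChainData (· ≤ · : X → X → Prop) Eq ρ N) := by
  constructor
  · rintro ⟨hX, 𝒞, hpart, hsymm⟩
    obtain ⟨ρ, N, h⟩ := hX.exists_isGraded
    refine ⟨ρ, N, h, ?_⟩
    choose k x hcov hsum hrange using hsymm
    have hsum' : ∀ C hC, 2 * ρ (x C hC 0) + k C hC = N := fun C hC => by
      have h1 := hsum C hC
      rw [h.posetRank_eq, h.posetRank_eq, h.totalRank_eq,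
        rank_add_of_forall_covBy h (hcov C hC) (Fin.last _), Fin.val_last] at h1
      have h2 : ρ (x C hC 0) + (ρ (x C hC 0) + k C hC) = N := by exact_mod_cast h1
      omega
    have hmem : ∀ C hC i, x C hC i ∈ C := fun C hC i =>
      (Set.ext_iff.1 (hrange C hC) _).2 ⟨i, rfl⟩
    refine ⟨{
      ι := 𝒞
      a := fun C => ρ (x C.1 C.2 0)
      c := fun C l => x C.1 C.2 (Fin.ofNat _ (l - ρ (x C.1 C.2 0)))
      two_mul_le := fun C => by have := hsum' C.1 C.2; omega
      rank_eq := ?_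
      rel := ?_
      exists_mem := ?_
      unique := ?_ }⟩
    · rintro ⟨C, hC⟩ l h1 h2
      have h3 := hsum' C hC
      dsimp only at *
      rw [rank_add_of_forall_covBy h (hcov C hC), Fin.val_ofNat, Nat.mod_eq_of_lt (by omega)]
      omega
    · rintro ⟨C, hC⟩ l h1 h2
      have h3 := hsum' C hC
      dsimp only at *
      have h4 := (hcov C hC ⟨l - ρ (x C hC 0), by omega⟩).le
      convert h4 using 2
      · ext
        simp only [Fin.val_ofNat, Fin.val_castSucc]
        exact Nat.mod_eq_of_lt (by omega)
      · ext
        simp only [Fin.val_ofNat, Fin.val_succ]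
        rw [Nat.mod_eq_of_lt (by omega)]
        omega
    · intro y
      obtain ⟨C, ⟨hC, hy⟩, -⟩ := hpart.2 y
      have h1 := hy
      rw [hrange C hC] at h1
      obtain ⟨i, rfl⟩ := h1
      have h2 := rank_add_of_forall_covBy h (hcov C hC) i
      have h3 := hsum' C hC
      have h4 := i.2
      refine ⟨⟨C, hC⟩, by dsimp only; omega, by dsimp only; omega, ?_⟩
      dsimp only
      congr 1
      ext
      rw [Fin.val_ofNat, h2, Nat.add_sub_cancel_left, Nat.mod_eq_of_lt h4]
    · rintro ⟨C, hC⟩ ⟨D, hD⟩ l h1 h2 h3 h4 h5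
      dsimp only at *
      rw [Subtype.mk.injEq]
      exact (hpart.2 (x C hC (Fin.ofNat _ (l - ρ (x C hC 0))))).unique ⟨hC, hmem _ _ _⟩
        ⟨hD, h5 ▸ hmem _ _ _⟩
  · rintro ⟨ρ, N, h, ⟨D⟩⟩
    let chain : D.ι → Set X := fun i => {x | ∃ k, D.a i ≤ k ∧ k + D.a i ≤ N ∧ D.c i k = x}
    refine ⟨h.isRanked, Set.range chain, ⟨?_, fun y => ?_⟩, ?_⟩
    · rintro ⟨i, hi⟩
      have h1 : D.c i (D.a i) ∈ chain i := ⟨D.a i, le_rfl, by linarith [D.two_mul_le i], rfl⟩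
      rw [hi] at h1
      exact h1
    · obtain ⟨i, h1, h2, h3⟩ := D.exists_mem y
      refine ⟨chain i, ⟨⟨i, rfl⟩, ⟨_, h1, h2, h3⟩⟩, ?_⟩
      rintro _ ⟨⟨j, rfl⟩, k, h4, h5, h6⟩
      have h7 := D.rank_eq j k h4 h5
      rw [h6] at h7
      subst h7
      rw [D.unique i j _ h1 h2 h4 h5 (h3.trans h6.symm)]
    · rintro _ ⟨i, rfl⟩
      have hi := D.two_mul_le i
      have hr : ∀ j : ℕ, j ≤ N - 2 * D.a i → ρ (D.c i (D.a i + j)) = D.a i + j := fun j hj =>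
        D.rank_eq i _ (by omega) (by omega)
      refine ⟨N - 2 * D.a i, fun j => D.c i (D.a i + j), fun j => ?_, ?_, ?_⟩
      · have hj := j.2
        refine h.covBy ?_ ?_
        · exact D.rel i (D.a i + j) (by omega) (by omega)
        · rw [hr _ (by simp), hr _ (by simp)]
          simp [add_assoc]
      · rw [h.posetRank_eq, h.posetRank_eq, h.totalRank_eq, hr _ (by simp), hr _ (by simp)]
        norm_cast
        simp
        omega
      · ext y
        constructor
        · rintro ⟨k, h1, h2, rfl⟩
          exact ⟨⟨k - D.a i, by omega⟩, by dsimp only; rw [Nat.add_sub_cancel' h1]⟩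
        · rintro ⟨j, rfl⟩
          have := j.2
          exact ⟨_, by omega, by omega, rfl⟩

/-! ### Levels in a symmetric chain decomposition -/

section Levels

variable {P : Type u} [PartialOrder P] {ρ : P → ℕ} {N : ℕ}
  (D : SymmChainData (· ≤ · : P → P → Prop) Eq ρ N)

namespace SymmChainData

/-- The index of the chain through `p`. -/
noncomputable def idx (p : P) : D.ι := (D.exists_mem p).choose

/-- The position of `p` in its chain, counted from `0`. -/
noncomputable def level (p : P) : ℤ := ρ p - D.a (D.idx p)

/-- The length of the chain through `p`. -/
noncomputable def length (p : P) : ℤ := N - 2 * D.a (D.idx p)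

/-- The element at position `l` of the chain through `p`, if `0 ≤ l ≤ D.length p`. -/
noncomputable def setLevel (p : P) (l : ℤ) : P := D.c (D.idx p) (D.a (D.idx p) + l.toNat)

theorem idx_spec (p : P) : D.a (D.idx p) ≤ ρ p ∧ ρ p + D.a (D.idx p) ≤ N ∧
    D.c (D.idx p) (ρ p) = p := (D.exists_mem p).choose_spec

theorem level_nonneg (p : P) : 0 ≤ D.level p := by
  have := (D.idx_spec p).1
  unfold level
  omega

theorem level_le_length (p : P) : D.level p ≤ D.length p := by
  have := (D.idx_spec p).2.1
  unfold level length
  omega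

theorem setLevel_level (p : P) : D.setLevel p (D.level p) = p := by
  obtain ⟨h1, h2, h3⟩ := D.idx_spec p
  unfold setLevel level
  rw [show D.a (D.idx p) + ((ρ p : ℤ) - D.a (D.idx p)).toNat = ρ p by omega, h3]

theorem rank_setLevel {p : P} {l : ℤ} (h0 : 0 ≤ l) (hl : l ≤ D.length p) :
    (ρ (D.setLevel p l) : ℤ) = D.a (D.idx p) + l := by
  unfold length at hl
  rw [setLevel, D.rank_eq _ _ (by omega) (by omega)]
  omega

theorem idx_setLevel {p : P} {l : ℤ} (h0 : 0 ≤ l) (hl : l ≤ D.length p) :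
    D.idx (D.setLevel p l) = D.idx p := by
  have h1 := D.rank_setLevel h0 hl
  unfold length at hl
  obtain ⟨h2, h3, h4⟩ := D.idx_spec (D.setLevel p l)
  have h5 : ρ (D.setLevel p l) = D.a (D.idx p) + l.toNat := by omega
  rw [h5] at h2 h3 h4
  exact D.unique _ _ _ h2 h3 (by omega) (by omega) h4

theorem level_setLevel {p : P} {l : ℤ} (h0 : 0 ≤ l) (hl : l ≤ D.length p) :
    D.level (D.setLevel p l) = l := by
  rw [level, D.rank_setLevel h0 hl, D.idx_setLevel h0 hl]
  ring

theorem length_setLevel {p : P} {l : ℤ} (h0 : 0 ≤ l) (hl : l ≤ D.length p) :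
    D.length (D.setLevel p l) = D.length p := by
  rw [length, D.idx_setLevel h0 hl, length]

theorem setLevel_setLevel {p : P} {l : ℤ} (h0 : 0 ≤ l) (hl : l ≤ D.length p) (l' : ℤ) :
    D.setLevel (D.setLevel p l) l' = D.setLevel p l' := by
  rw [setLevel, D.idx_setLevel h0 hl, setLevel]

theorem setLevel_mono {p : P} {l l' : ℤ} (h0 : 0 ≤ l) (hll : l ≤ l') (hl : l' ≤ D.length p) :
    D.setLevel p l ≤ D.setLevel p l' := by
  obtain ⟨n, rfl⟩ : ∃ n : ℕ, l' = l + n := ⟨(l' - l).toNat, by omega⟩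
  induction n with
  | zero => simp
  | succ n ih =>
    refine (ih (by omega) (by push_cast at hl; omega)).trans ?_
    unfold setLevel
    rw [show D.a (D.idx p) + (l + (n + 1 : ℕ)).toNat = D.a (D.idx p) + (l + n).toNat + 1 by omega]
    unfold length at hl
    exact D.rel _ _ (by omega) (by omega)

end SymmChainData

end Levels

/-! ### Periodic sequences modulo shifts -/

section PeriodicSequences

/-- Sequences in `P` of period `k`; they stand for the functions on a cycle of length `k`. -/
abbrev PeriodicSeq (P : Type u) (k : ℤ) : Type u := {z : ℤ → P // ∀ i, z (i + k) = z i}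

variable {P : Type u} {k : ℤ}

/-- The sequence `z`, moved by `s` places. -/
def PeriodicSeq.shift (z : PeriodicSeq P k) (s : ℤ) : PeriodicSeq P k :=
  ⟨fun i => z.1 (i + s), fun i => by dsimp only; rw [add_right_comm, z.2]⟩

theorem apply_add_mul_of_periodic {α : Type*} {f : ℤ → α} {k : ℤ} (h : ∀ i, f (i + k) = f i)
    (i t : ℤ) : f (i + t * k) = f i := by
  simpa using (show Function.Periodic f k from h).int_mul t i

theorem PeriodicSeq.finite [Finite P] (hk : 0 < k) : Finite (PeriodicSeq P k) := by
  refine Finite.of_injective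
    (fun (z : PeriodicSeq P k) (i : Finset.Ioc (0 : ℤ) k) => z.1 i) fun z z' h => ?_
  refine Subtype.ext (funext fun i => ?_)
  obtain ⟨l, t, h1, h2, rfl, -⟩ := exists_window hk 0 i
  have h3 := congrFun h ⟨l, by simp; omega⟩
  rw [apply_add_mul_of_periodic z.2, apply_add_mul_of_periodic z'.2]
  exact h3

/-- The rank of a periodic sequence: the sum of the ranks over one period. -/
noncomputable def seqRank (ρ : P → ℕ) (z : PeriodicSeq P k) : ℕ :=
  ∑ l ∈ Finset.Ioc 0 k, ρ (z.1 l)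

theorem seqRank_eq_prefixSum (hk : 0 < k) (ρ : P → ℕ) (z : PeriodicSeq P k) :
    (seqRank ρ z : ℤ) = prefixSum (fun l => ρ (z.1 l)) k := by
  rw [prefixSum_of_nonneg _ hk.le, seqRank]
  push_cast
  rfl

theorem seqRank_shift (hk : 0 < k) (ρ : P → ℕ) (z : PeriodicSeq P k) (s : ℤ) :
    seqRank ρ (z.shift s) = seqRank ρ z := by
  zify
  rw [seqRank_eq_prefixSum hk, seqRank_eq_prefixSum hk]
  have h1 := prefixSum_shift (fun l => (ρ (z.1 l) : ℤ)) s k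
  have h2 := prefixSum_add_period (x := fun l => (ρ (z.1 l) : ℤ)) (k := k)
    (fun i => by rw [z.2]) s
  rw [add_comm k s, h2] at h1
  rw [show prefixSum (fun l => (ρ ((z.shift s).1 l) : ℤ)) k = _ from h1]
  ring

variable [PartialOrder P] {ρ : P → ℕ} {N : ℕ}
  (D : SymmChainData (· ≤ · : P → P → Prop) Eq ρ N)

namespace SymmChainData

/-- The sequence of levels of a periodic sequence. -/
noncomputable def levels (z : PeriodicSeq P k) (i : ℤ) : ℤ := D.level (z.1 i)

/-- The sequence of the lengths of the chains through the entries of a periodic sequence. -/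
noncomputable def lengths (z : PeriodicSeq P k) (i : ℤ) : ℤ := D.length (z.1 i)

open Classical in
/-- The sequence with levels `y` in the same chains as `z`, provided `y` is `k`-periodic (a junk
value otherwise). -/
noncomputable def withLevels (z : PeriodicSeq P k) (y : ℤ → ℤ) : PeriodicSeq P k :=
  if h : ∀ i, y (i + k) = y i then
    ⟨fun i => D.setLevel (z.1 i) (y i), fun i => by dsimp only; rw [z.2, h]⟩
  else z

theorem levels_add_period (z : PeriodicSeq P k) (i : ℤ) : D.levels z (i + k) = D.levels z i := by
  rw [levels, z.2, levels]

theorem lengths_add_period (z : PeriodicSeq P k) (i : ℤ) :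
    D.lengths z (i + k) = D.lengths z i := by
  rw [lengths, z.2, lengths]

theorem levels_nonneg (z : PeriodicSeq P k) (i : ℤ) : 0 ≤ D.levels z i := D.level_nonneg _

theorem levels_le_lengths (z : PeriodicSeq P k) (i : ℤ) : D.levels z i ≤ D.lengths z i :=
  D.level_le_length _

/-- The drift of the valleys is the difference between the total rank and twice the rank. -/
theorem prefixSum_lengths_sub (hk : 0 < k) (z : PeriodicSeq P k) :
    prefixSum (D.lengths z) k - 2 * prefixSum (D.levels z) k =
      (N * k.toNat : ℕ) - 2 * (seqRank ρ z : ℤ) := by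
  rw [prefixSum_of_nonneg _ hk.le, prefixSum_of_nonneg _ hk.le, seqRank]
  unfold lengths levels length level
  push_cast
  rw [Finset.sum_sub_distrib, Finset.sum_sub_distrib, ← Finset.mul_sum, Finset.sum_const,
    Int.card_Ioc, sub_zero, nsmul_eq_mul]
  ring

variable {D} {z : PeriodicSeq P k} {y y' : ℤ → ℤ}

theorem withLevels_apply (hy : ∀ i, y (i + k) = y i) (i : ℤ) :
    (D.withLevels z y).1 i = D.setLevel (z.1 i) (y i) := by
  rw [withLevels, dif_pos hy]

theorem levels_withLevels (hy : ∀ i, y (i + k) = y i) (h0 : ∀ i, 0 ≤ y i)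
    (hl : ∀ i, y i ≤ D.lengths z i) : D.levels (D.withLevels z y) = y := by
  funext i
  rw [levels, withLevels_apply hy, D.level_setLevel (h0 i) (hl i)]

theorem lengths_withLevels (hy : ∀ i, y (i + k) = y i) (h0 : ∀ i, 0 ≤ y i)
    (hl : ∀ i, y i ≤ D.lengths z i) : D.lengths (D.withLevels z y) = D.lengths z := by
  funext i
  rw [lengths, withLevels_apply hy, D.length_setLevel (h0 i) (hl i), lengths]

theorem withLevels_withLevels (hy : ∀ i, y (i + k) = y i) (h0 : ∀ i, 0 ≤ y i)
    (hl : ∀ i, y i ≤ D.lengths z i) (hy' : ∀ i, y' (i + k) = y' i) :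
    D.withLevels (D.withLevels z y) y' = D.withLevels z y' := by
  refine Subtype.ext (funext fun i => ?_)
  rw [withLevels_apply hy', withLevels_apply hy', withLevels_apply hy,
    D.setLevel_setLevel (h0 i) (hl i)]

theorem withLevels_levels (z : PeriodicSeq P k) : D.withLevels z (D.levels z) = z := by
  refine Subtype.ext (funext fun i => ?_)
  rw [withLevels_apply (D.levels_add_period z), levels, D.setLevel_level]

theorem withLevels_le (hy : ∀ i, y (i + k) = y i) (hy' : ∀ i, y' (i + k) = y' i)
    (h0 : ∀ i, 0 ≤ y i) (hyy : ∀ i, y i ≤ y' i) (hl : ∀ i, y' i ≤ D.lengths z i) (i : ℤ) :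
    (D.withLevels z y).1 i ≤ (D.withLevels z y').1 i := by
  rw [withLevels_apply hy, withLevels_apply hy']
  exact D.setLevel_mono (h0 i) (hyy i) (hl i)

theorem withLevels_shift (hy : ∀ i, y (i + k) = y i) (s : ℤ) :
    D.withLevels (z.shift s) (fun i => y (i + s)) = (D.withLevels z y).shift s := by
  refine Subtype.ext (funext fun i => ?_)
  rw [withLevels_apply fun i => by rw [add_right_comm, hy]]
  exact (withLevels_apply hy (i + s)).symm

theorem seqRank_withLevels (hk : 0 < k) (hy : ∀ i, y (i + k) = y i) (h0 : ∀ i, 0 ≤ y i)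
    (hl : ∀ i, y i ≤ D.lengths z i) :
    (seqRank ρ (D.withLevels z y) : ℤ) - seqRank ρ z =
      prefixSum y k - prefixSum (D.levels z) k := by
  have h1 := D.prefixSum_lengths_sub hk z
  have h2 := D.prefixSum_lengths_sub hk (D.withLevels z y)
  rw [levels_withLevels hy h0 hl, lengths_withLevels hy h0 hl] at h2
  omega

variable (D) in
/-- `z'` arises from `z` by moving one entry up in its chain, at the right end of a widest gap. -/
def Raises (z z' : PeriodicSeq P k) : Prop :=
  ∃ i j, IsWidestGap (D.lengths z) (D.levels z) i j ∧
    z' = D.withLevels z (raiseAt k (D.levels z) j)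

theorem raiseAt_levels_nonneg (z : PeriodicSeq P k) (j i : ℤ) :
    0 ≤ raiseAt k (D.levels z) j i := by
  have := D.levels_nonneg z i
  unfold raiseAt
  split_ifs <;> omega

theorem raiseAt_levels_le {i j : ℤ} (h : IsWidestGap (D.lengths z) (D.levels z) i j) (l : ℤ) :
    raiseAt k (D.levels z) j l ≤ D.lengths z l := by
  have h1 := D.levels_le_lengths z l
  unfold raiseAt
  split_ifs with h2
  · obtain ⟨t, ht⟩ := h2
    have h3 := h.gap.lt_up (D.levels_nonneg z)
    have h4 := apply_add_mul_of_periodic (D.lengths_add_period z) j t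
    have h5 := apply_add_mul_of_periodic (D.levels_add_period z) j t
    rw [show j + t * k = l by linarith] at h4 h5
    omega
  · omega

theorem exists_raises (hk : 0 < k) (hz : 2 * seqRank ρ z + 2 ≤ N * k.toNat) :
    ∃ z', D.Raises z z' := by
  have h := D.prefixSum_lengths_sub hk z
  obtain ⟨i, j, hij⟩ := exists_isWidestGap hk (D.lengths_add_period z) (D.levels_add_period z)
    (D.levels_nonneg z) (by omega)
  exact ⟨_, i, j, hij, rfl⟩

theorem Raises.seqRank_eq (hk : 0 < k) {z' : PeriodicSeq P k} (h : D.Raises z z') :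
    seqRank ρ z' = seqRank ρ z + 1 := by
  obtain ⟨i, j, hij, rfl⟩ := h
  have h1 := seqRank_withLevels hk (raiseAt_add_period (D.levels_add_period z) j)
    (raiseAt_levels_nonneg z j) (raiseAt_levels_le hij)
  rw [prefixSum_raiseAt_period hk] at h1
  omega

theorem Raises.le {z' : PeriodicSeq P k} (h : D.Raises z z') (i : ℤ) : z.1 i ≤ z'.1 i := by
  obtain ⟨_, j, hij, rfl⟩ := h
  conv_lhs => rw [← withLevels_levels (D := D) z]
  refine withLevels_le (D.levels_add_period z) (raiseAt_add_period (D.levels_add_period z) j)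
    (D.levels_nonneg z) (fun l => ?_) (raiseAt_levels_le hij) i
  unfold raiseAt
  split_ifs <;> omega

theorem Raises.injective (hk : 0 < k) {z₁ z₂ z' : PeriodicSeq P k}
    (hz₁ : 2 * seqRank ρ z₁ + 2 ≤ N * k.toNat) (hz₂ : 2 * seqRank ρ z₂ + 2 ≤ N * k.toNat)
    (h₁ : D.Raises z₁ z') (h₂ : D.Raises z₂ z') : z₁ = z₂ := by
  obtain ⟨i₁, j₁, w₁, e₁⟩ := h₁
  obtain ⟨i₂, j₂, w₂, e₂⟩ := h₂
  have p₁ := raiseAt_add_period (D.levels_add_period z₁) j₁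
  have p₂ := raiseAt_add_period (D.levels_add_period z₂) j₂
  have l₁ := levels_withLevels p₁ (raiseAt_levels_nonneg z₁ j₁) (raiseAt_levels_le w₁)
  have l₂ := levels_withLevels p₂ (raiseAt_levels_nonneg z₂ j₂) (raiseAt_levels_le w₂)
  have m₁ := lengths_withLevels p₁ (raiseAt_levels_nonneg z₁ j₁) (raiseAt_levels_le w₁)
  have m₂ := lengths_withLevels p₂ (raiseAt_levels_nonneg z₂ j₂) (raiseAt_levels_le w₂)
  rw [← e₁] at l₁ m₁
  rw [← e₂] at l₂ m₂
  have d₁ := D.prefixSum_lengths_sub hk z₁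
  have d₂ := D.prefixSum_lengths_sub hk z₂
  rw [← m₁] at w₁ d₁
  rw [← m₂] at w₂ d₂
  obtain ⟨t, ht⟩ := IsWidestGap.dvd_sub_of_raiseAt_eq hk (D.lengths_add_period z')
    (D.levels_add_period z₁) (D.levels_nonneg z₁) (by omega)
    (D.levels_add_period z₂) (D.levels_nonneg z₂) (by omega) w₁ w₂ (l₁.symm.trans l₂)
  have hlev : D.levels z₁ = D.levels z₂ := by
    funext i
    have h1 := congrFun (l₁.symm.trans l₂) i
    have h2 : k ∣ i - j₂ ↔ k ∣ i - j₁ := by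
      rw [show i - j₁ = i - j₂ + k * t by linarith, dvd_add_left (dvd_mul_right _ _)]
    simpa only [raiseAt, h2, add_left_inj] using h1
  rw [← withLevels_levels (D := D) z₁, ← withLevels_levels (D := D) z₂,
    ← withLevels_withLevels p₁ (raiseAt_levels_nonneg z₁ j₁) (raiseAt_levels_le (m₁ ▸ w₁))
      (D.levels_add_period z₁),
    ← withLevels_withLevels p₂ (raiseAt_levels_nonneg z₂ j₂) (raiseAt_levels_le (m₂ ▸ w₂))
      (D.levels_add_period z₂), ← e₁, ← e₂, hlev]

theorem Raises.shift {z' : PeriodicSeq P k} (h : D.Raises z z') (s : ℤ) :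
    D.Raises (z.shift s) (z'.shift s) := by
  obtain ⟨i, j, w, rfl⟩ := h
  refine ⟨i - s, j - s, w.shift s, ?_⟩
  rw [← withLevels_shift (raiseAt_add_period (D.levels_add_period z) j)]
  congr 1
  funext l
  exact (raiseAt_shift k (D.levels z) s j l).symm

variable (D) in
/-- The mirror image of a periodic sequence in the lower half. -/
noncomputable def mirrorSeq (z : PeriodicSeq P k) : PeriodicSeq P k :=
  D.withLevels z (mirror (D.lengths z) (D.levels z))

section Mirror

variable (hk : 0 < k)
include hk

section

variable (hz : 2 * seqRank ρ z ≤ N * k.toNat)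
include hz

theorem drift_nonneg : 0 ≤ prefixSum (D.lengths z) k - 2 * prefixSum (D.levels z) k := by
  have := D.prefixSum_lengths_sub hk z
  omega

theorem mirror_levels_add_period (i : ℤ) : mirror (D.lengths z) (D.levels z) (i + k) =
    mirror (D.lengths z) (D.levels z) i :=
  mirror_add_period hk (D.lengths_add_period z) (D.levels_add_period z) (drift_nonneg hk hz) i

theorem levels_le_mirror (i : ℤ) : D.levels z i ≤ mirror (D.lengths z) (D.levels z) i :=
  le_mirror hk (D.lengths_add_period z) (D.levels_add_period z) (drift_nonneg hk hz) i

theorem mirror_levels_nonneg (i : ℤ) : 0 ≤ mirror (D.lengths z) (D.levels z) i :=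
  (D.levels_nonneg z i).trans (levels_le_mirror hk hz i)

theorem mirror_levels_le (i : ℤ) : mirror (D.lengths z) (D.levels z) i ≤ D.lengths z i :=
  mirror_le hk (D.lengths_add_period z) (D.levels_add_period z) (drift_nonneg hk hz)
    (D.levels_nonneg z) (D.levels_le_lengths z) i

theorem le_mirrorSeq (i : ℤ) : z.1 i ≤ (D.mirrorSeq z).1 i := by
  conv_lhs => rw [← withLevels_levels (D := D) z]
  exact withLevels_le (D.levels_add_period z) (mirror_levels_add_period hk hz)
    (D.levels_nonneg z) (levels_le_mirror hk hz) (mirror_levels_le hk hz) i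

theorem seqRank_mirrorSeq : seqRank ρ (D.mirrorSeq z) + seqRank ρ z = N * k.toNat := by
  have h1 := seqRank_withLevels (D := D) hk (mirror_levels_add_period hk hz)
    (mirror_levels_nonneg hk hz) (mirror_levels_le hk hz)
  rw [prefixSum_mirror_period hk (D.lengths_add_period z) (D.levels_add_period z)
    (drift_nonneg hk hz)] at h1
  have h2 := D.prefixSum_lengths_sub hk z
  unfold mirrorSeq
  omega

theorem mirrorSeq_shift (s : ℤ) : D.mirrorSeq (z.shift s) = (D.mirrorSeq z).shift s := by
  unfold mirrorSeq
  rw [← withLevels_shift (mirror_levels_add_period hk hz)]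
  congr 1
  funext i
  exact mirror_shift hk (D.lengths_add_period z) (D.levels_add_period z) (drift_nonneg hk hz) s i

end

theorem mirrorSeq_eq_self (hz : 2 * seqRank ρ z = N * k.toNat) : D.mirrorSeq z = z := by
  have := D.prefixSum_lengths_sub hk z
  unfold mirrorSeq
  rw [mirror_eq_self hk (D.lengths_add_period z) (D.levels_add_period z) (by omega) (by omega),
    withLevels_levels]

theorem mirrorSeq_injective {z₁ z₂ : PeriodicSeq P k}
    (hz₁ : 2 * seqRank ρ z₁ ≤ N * k.toNat) (hz₂ : 2 * seqRank ρ z₂ ≤ N * k.toNat)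
    (h : D.mirrorSeq z₁ = D.mirrorSeq z₂) : z₁ = z₂ := by
  have p₁ := mirror_levels_add_period (D := D) hk hz₁
  have p₂ := mirror_levels_add_period (D := D) hk hz₂
  have l₁ := levels_withLevels p₁ (mirror_levels_nonneg hk hz₁) (mirror_levels_le hk hz₁)
  have l₂ := levels_withLevels p₂ (mirror_levels_nonneg hk hz₂) (mirror_levels_le hk hz₂)
  have m₁ := lengths_withLevels p₁ (mirror_levels_nonneg hk hz₁) (mirror_levels_le hk hz₁)
  have m₂ := lengths_withLevels p₂ (mirror_levels_nonneg hk hz₂) (mirror_levels_le hk hz₂)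
  have hm : D.lengths z₁ = D.lengths z₂ := by
    rw [← m₁, ← m₂]
    exact congrArg _ h
  have hl : mirror (D.lengths z₁) (D.levels z₁) = mirror (D.lengths z₂) (D.levels z₂) := by
    rw [← l₁, ← l₂]
    exact congrArg _ h
  rw [hm] at hl
  have hlev := mirror_injective hk (D.lengths_add_period z₂) (D.levels_add_period z₁)
    (hm ▸ drift_nonneg hk hz₁) (D.levels_add_period z₂) (drift_nonneg hk hz₂) hl
  have e₁ := withLevels_withLevels p₁ (mirror_levels_nonneg hk hz₁) (mirror_levels_le hk hz₁)
    (D.levels_add_period z₁)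
  have e₂ := withLevels_withLevels p₂ (mirror_levels_nonneg hk hz₂) (mirror_levels_le hk hz₂)
    (D.levels_add_period z₂)
  rw [withLevels_levels] at e₁ e₂
  exact e₁.symm.trans ((congrArg₂ D.withLevels h hlev).trans e₂)

theorem Raises.mirrorSeq_le {z' : PeriodicSeq P k} (hz : 2 * seqRank ρ z + 2 ≤ N * k.toNat)
    (h : D.Raises z z') (i : ℤ) : (D.mirrorSeq z').1 i ≤ (D.mirrorSeq z).1 i := by
  have hr := h.seqRank_eq hk
  have hz' : 2 * seqRank ρ z' ≤ N * k.toNat := by omega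
  have hz0 : 2 * seqRank ρ z ≤ N * k.toNat := by omega
  have hd := D.prefixSum_lengths_sub hk z
  have q1 := mirror_levels_add_period (D := D) hk hz'
  have q2 := mirror_levels_nonneg (D := D) hk hz'
  obtain ⟨_, j, w, rfl⟩ := h
  have p1 := raiseAt_add_period (D.levels_add_period z) j
  have p2 := raiseAt_levels_nonneg (D := D) z j
  have p3 := raiseAt_levels_le w
  rw [levels_withLevels p1 p2 p3, lengths_withLevels p1 p2 p3] at q1 q2
  unfold mirrorSeq
  rw [levels_withLevels p1 p2 p3, lengths_withLevels p1 p2 p3, withLevels_withLevels p1 p2 p3 q1]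
  exact withLevels_le q1 (mirror_levels_add_period hk hz0) q2
    (mirror_raiseAt_le hk (D.lengths_add_period z) (D.levels_add_period z) (by omega) w.gap)
    (mirror_levels_le hk hz0) i

/-- Turning all chains upside down shows that there are as many sequences in the upper half as in
the lower half, so that taking mirror images is surjective. -/
theorem exists_mirrorSeq_eq [Finite P] {w : PeriodicSeq P k}
    (hw : N * k.toNat ≤ 2 * seqRank ρ w) :
    ∃ z, 2 * seqRank ρ z ≤ N * k.toNat ∧ D.mirrorSeq z = w := by
  have := PeriodicSeq.finite (P := P) hk
  -- `f` reverses each chain, and `g` is the injection of a rank of the lower half into itself that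
  -- results from mirroring and reversing
  let f : PeriodicSeq P k → PeriodicSeq P k := fun z =>
    D.withLevels z fun i => D.lengths z i - D.levels z i
  have p : ∀ (z : PeriodicSeq P k) i, D.lengths z (i + k) - D.levels z (i + k) =
      D.lengths z i - D.levels z i := fun z i => by
    rw [D.lengths_add_period, D.levels_add_period]
  have p0 : ∀ (z : PeriodicSeq P k) i, 0 ≤ D.lengths z i - D.levels z i := fun z i => by
    have := D.levels_le_lengths z i
    omega
  have pl : ∀ (z : PeriodicSeq P k) i, D.lengths z i - D.levels z i ≤ D.lengths z i :=
    fun z i => by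
      have := D.levels_nonneg z i
      omega
  have hf : ∀ z, f (f z) = z := fun z => by
    simp only [f]
    rw [levels_withLevels (p z) (p0 z) (pl z), lengths_withLevels (p z) (p0 z) (pl z),
      withLevels_withLevels (p z) (p0 z) (pl z) 
        fun i => by simp only [D.lengths_add_period, D.levels_add_period]]
    simp only [sub_sub_cancel]
    exact withLevels_levels z
  have hfr : ∀ z, seqRank ρ (f z) + seqRank ρ z = N * k.toNat := fun z => by
    have h1 := D.prefixSum_lengths_sub hk z
    have h2 := D.prefixSum_lengths_sub hk (f z)
    have h3 := seqRank_withLevels hk (p z) (p0 z) (pl z)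
    rw [prefixSum_of_nonneg _ hk.le, Finset.sum_sub_distrib, ← prefixSum_of_nonneg _ hk.le,
      ← prefixSum_of_nonneg _ hk.le] at h3
    simp only [f] at *
    omega
  let S := {z : PeriodicSeq P k // seqRank ρ z = seqRank ρ (f w)}
  have hS : ∀ z : S, 2 * seqRank ρ z.1 ≤ N * k.toNat := fun z => by
    have h1 := z.2
    have h2 := hfr w
    omega
  let g : S → S := fun z => ⟨f (D.mirrorSeq z.1), by
    have h1 := hfr (D.mirrorSeq z.1)
    have h2 := seqRank_mirrorSeq (D := D) hk (hS z)
    have h3 := z.2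
    omega⟩
  have hg : Function.Injective g := fun z₁ z₂ h => by
    have h1 := congrArg f (congrArg Subtype.val h)
    simp only [g, hf] at h1
    exact Subtype.ext (mirrorSeq_injective hk (hS z₁) (hS z₂) h1)
  obtain ⟨z, hz⟩ := Finite.injective_iff_surjective.1 hg ⟨f w, rfl⟩
  have h1 := congrArg f (congrArg Subtype.val hz)
  simp only [g, hf] at h1
  exact ⟨z.1, hS z, h1⟩

end Mirror

/-- Sequences that differ by a shift by a multiple of `r`. -/
def shiftSetoid (P : Type u) (k r : ℤ) : Setoid (PeriodicSeq P k) where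
  r z z' := ∃ t : ℤ, z = z'.shift (r * t)
  iseqv :=
    { refl := fun z => ⟨0, Subtype.ext (funext fun i => by simp [PeriodicSeq.shift])⟩
      symm := by
        rintro z z' ⟨t, rfl⟩
        refine ⟨-t, Subtype.ext (funext fun i => ?_)⟩
        simp [PeriodicSeq.shift]
      trans := by
        rintro z z' z'' ⟨t, rfl⟩ ⟨t', rfl⟩
        refine ⟨t + t', Subtype.ext (funext fun i => ?_)⟩
        simp only [PeriodicSeq.shift, mul_add, add_assoc] }

/-- Necklaces: the periodic sequences modulo shifts by multiples of `r` have a symmetric chain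
decomposition. -/
theorem nonempty_periodicSeq [Finite P] (D : SymmChainData (· ≤ · : P → P → Prop) Eq ρ N)
    (hk : 0 < k) (r : ℤ) :
    Nonempty (SymmChainData (X := PeriodicSeq P k)
      (fun z z' => ∃ t : ℤ, ∀ i, z.1 i ≤ z'.1 (i + r * t))
      (fun z z' => ∃ t : ℤ, z = z'.shift (r * t)) (seqRank ρ) (N * k.toNat)) := by
  classical
  let S := shiftSetoid P k r
  let Q := Quotient S
  let rk : Q → ℕ := Quotient.lift (seqRank ρ) (by
    rintro z z' ⟨t, rfl⟩
    exact seqRank_shift hk ρ z' _)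
  -- `mirrorSeq` commutes with shifts only in the lower half, whence the case distinction
  let star : Q → Q := fun q =>
    Quotient.mk S (if 2 * rk q ≤ N * k.toNat then D.mirrorSeq q.out else q.out)
  let R : Q → Q → Prop := fun q q' => ∃ z z' : PeriodicSeq P k,
    Quotient.mk S z = q ∧ Quotient.mk S z' = q' ∧ ∀ i, z.1 i ≤ z'.1 i
  have hout : ∀ q : Q, seqRank ρ q.out = rk q := fun q => by
    conv_rhs => rw [← q.out_eq]
    rfl
  have hstar : ∀ z : PeriodicSeq P k, 2 * seqRank ρ z ≤ N * k.toNat →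
      star (Quotient.mk S z) = Quotient.mk S (D.mirrorSeq z) := fun z hz => by
    have h1 : 2 * rk (Quotient.mk S z) ≤ N * k.toNat := hz
    simp only [star, if_pos h1]
    obtain ⟨t, ht⟩ : ∃ t : ℤ, (Quotient.mk S z).out = z.shift (r * t) :=
      Quotient.exact (Quotient.mk S z).out_eq
    rw [ht, mirrorSeq_shift hk hz]
    exact Quotient.sound ⟨t, rfl⟩
  have hex : ∀ q : Q, ∃ q' : Q, 2 * rk q + 2 ≤ N * k.toNat →
      ∃ z', D.Raises q.out z' ∧ Quotient.mk S z' = q' := fun q => by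
    by_cases hq : 2 * rk q + 2 ≤ N * k.toNat
    · obtain ⟨z', hz'⟩ := exists_raises (D := D) (z := q.out) hk (by rw [hout]; exact hq)
      exact ⟨_, fun _ => ⟨z', hz', rfl⟩⟩
    · exact ⟨q, fun h => absurd h hq⟩
  -- one raise of one representative is chosen in each orbit
  choose up hup using hex
  have DQ : SymmChainData R Eq rk (N * k.toNat) := by
    refine SymmChainData.ofRaise (up := up) (star := star) ?_ ?_ ?_ ?_ ?_ ?_ ?_ ?_ ?_
    · intro q hq
      obtain ⟨z', h1, h2⟩ := hup q hq
      rw [← h2, ← hout q]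
      exact h1.seqRank_eq hk
    · intro q hq
      obtain ⟨z', h1, h2⟩ := hup q hq
      exact ⟨q.out, z', q.out_eq, h2, h1.le⟩
    · intro q₁ q₂ hq₁ hq₂ he
      obtain ⟨z₁, h1, h2⟩ := hup q₁ hq₁
      obtain ⟨z₂, h3, h4⟩ := hup q₂ hq₂
      obtain ⟨t, rfl⟩ : ∃ t : ℤ, z₁ = z₂.shift (r * t) :=
        Quotient.exact (h2.trans (he.trans h4.symm))
      have h5 := h1.injective hk (by rw [hout]; exact hq₁)
        (by rw [seqRank_shift hk, hout]; exact hq₂) (h3.shift (r * t))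
      rw [← q₁.out_eq, ← q₂.out_eq, h5]
      exact Quotient.sound ⟨t, rfl⟩
    · intro q hq
      have h1 : 2 * seqRank ρ q.out ≤ N * k.toNat := by rwa [hout]
      have h2 := hstar q.out h1
      rw [q.out_eq] at h2
      rw [h2, ← hout q]
      exact seqRank_mirrorSeq hk h1
    · intro q₁ q₂ hq₁ hq₂ he
      have h1 : 2 * seqRank ρ q₁.out ≤ N * k.toNat := by rwa [hout]
      have h2 : 2 * seqRank ρ q₂.out ≤ N * k.toNat := by rwa [hout]
      have h3 := hstar q₁.out h1
      have h4 := hstar q₂.out h2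
      rw [q₁.out_eq] at h3
      rw [q₂.out_eq] at h4
      obtain ⟨t, ht⟩ : ∃ t : ℤ, D.mirrorSeq q₁.out = (D.mirrorSeq q₂.out).shift (r * t) :=
        Quotient.exact (h3.symm.trans (he.trans h4))
      rw [← mirrorSeq_shift hk h2] at ht
      have h5 := mirrorSeq_injective hk h1 (by rwa [seqRank_shift hk]) ht
      rw [← q₁.out_eq, ← q₂.out_eq, h5]
      exact Quotient.sound ⟨t, rfl⟩
    · intro q hq
      obtain ⟨z, h1, h2⟩ := exists_mirrorSeq_eq (D := D) (w := q.out) hk (by rwa [hout])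
      exact ⟨Quotient.mk S z, h1, by rw [hstar z h1, h2, q.out_eq]⟩
    · intro q hq
      have h1 : 2 * seqRank ρ q.out = N * k.toNat := by rwa [hout]
      have h2 := hstar q.out h1.le
      rwa [mirrorSeq_eq_self hk h1, q.out_eq] at h2
    · intro q hq
      have h1 : 2 * seqRank ρ q.out ≤ N * k.toNat := by rw [hout]; omega
      have h2 := hstar q.out h1
      rw [q.out_eq] at h2
      exact ⟨q.out, D.mirrorSeq q.out, q.out_eq, h2.symm, le_mirrorSeq hk h1⟩
    · intro q hq
      obtain ⟨z', h1, h2⟩ := hup q hq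
      have h3 : 2 * seqRank ρ q.out + 2 ≤ N * k.toNat := by rwa [hout]
      have h4 := h1.seqRank_eq hk
      have h5 := hstar q.out (by omega)
      rw [q.out_eq] at h5
      exact ⟨D.mirrorSeq z', D.mirrorSeq q.out, by rw [← h2, hstar z' (by omega)], h5.symm,
        h1.mirrorSeq_le hk h3⟩
  refine ⟨DQ.map Quotient.out hout ?_ ?_ ?_⟩
  · rintro q q' ⟨z, z', rfl, rfl, h⟩
    obtain ⟨t, ht⟩ : ∃ t : ℤ, (Quotient.mk S z).out = z.shift (r * t) :=
      Quotient.exact (Quotient.mk S z).out_eq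
    obtain ⟨t', ht'⟩ : ∃ t : ℤ, z' = (Quotient.mk S z').out.shift (r * t) :=
      Quotient.exact (Quotient.mk S z').out_eq.symm
    refine ⟨t + t', fun i => ?_⟩
    rw [ht]
    have h1 := h (i + r * t)
    have h2 := congrArg (fun w => w.1 (i + r * t)) ht'
    dsimp only [PeriodicSeq.shift] at h2 ⊢
    rw [h2] at h1
    rwa [mul_add, ← add_assoc]
  · intro z
    refine ⟨Quotient.mk S z, rfl, ?_⟩
    rintro q rfl
    exact Quotient.exact (Quotient.mk S z).out_eq
  · intro q q' h
    rw [← q.out_eq, ← q'.out_eq]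
    exact Quotient.sound h

end SymmChainData

end PeriodicSequences

/-! ### Powers and quotients of graded orders -/

section GradedConstructions

theorem IsGraded.pi {P ι : Type*} [PartialOrder P] [Fintype ι] {ρ : P → ℕ} {N : ℕ}
    (h : IsGraded ρ N) : IsGraded (fun x : ι → P => ∑ i, ρ (x i)) (∑ _i : ι, N) := by
  classical
  have := h.finite
  refine ⟨inferInstance, ?_, fun x y hxy => ?_, fun x y hxy => ?_, fun x => ?_⟩
  · obtain ⟨z, hz, hz0⟩ := h.exists_min
    exact ⟨fun _ => z, fun x i => hz _, by simp [hz0]⟩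
  · obtain ⟨hle, i, hi⟩ := Pi.lt_def.1 hxy
    exact Finset.sum_lt_sum (fun j _ => h.strictMono.monotone (hle j))
      ⟨i, Finset.mem_univ _, h.strictMono hi⟩
  · obtain ⟨hle, i, hi⟩ := Pi.lt_def.1 hxy
    obtain ⟨w, h1, h2, h3⟩ := h.exists_step _ _ hi
    refine ⟨Function.update x i w, lt_update_self_iff.2 h1,
      update_le_iff.2 ⟨h2, fun j _ => hle j⟩, ?_⟩
    rw [← Finset.add_sum_erase _ _ (Finset.mem_univ i),
      ← Finset.add_sum_erase Finset.univ (fun j => ρ (x j)) (Finset.mem_univ i),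
      Function.update_self, h3, Finset.sum_congr rfl fun j hj => by
        rw [Function.update_of_ne (Finset.ne_of_mem_erase hj)]]
    ring
  · choose y hy hyN using fun i => h.exists_top (x i)
    exact ⟨y, hy, by simp only [hyN]⟩

/-- The quotient of a graded order by automorphisms is graded by the rank of representatives. -/
theorem IsGraded.exists_orbitPoset {X : Type*} [PartialOrder X] {H : Subgroup (X ≃o X)} [Finite H]
    {ρ : X → ℕ} {N : ℕ} (h : IsGraded ρ N) (hinv : ∀ g ∈ H, ∀ x, ρ (g x) = ρ x) :
    ∃ ρ' : OrbitPoset H → ℕ, (∀ x, ρ' (OrbitPoset.mk H x) = ρ x) ∧ IsGraded ρ' N := by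
  let ρ' : OrbitPoset H → ℕ := fun a => ρ a.exists_mk.choose
  have hρ' : ∀ x, ρ' (OrbitPoset.mk H x) = ρ x := fun x => by
    obtain ⟨g, hg, h1⟩ := OrbitPoset.mk_eq_mk.1 (OrbitPoset.mk H x).exists_mk.choose_spec
    simp only [ρ']
    rw [← h1, hinv g hg]
  have hlt : ∀ {x y : X}, OrbitPoset.mk H x < OrbitPoset.mk H y → ∃ g ∈ H, x < g y := by
    intro x y hxy
    obtain ⟨g, hg, hle⟩ := OrbitPoset.mk_le_mk.1 hxy.le
    refine ⟨g, hg, hle.lt_of_ne fun he => hxy.ne ?_⟩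
    exact OrbitPoset.mk_eq_mk.2 ⟨g, hg, he.symm⟩
  have hle : ∀ {x y : X}, x ≤ y → OrbitPoset.mk H x ≤ OrbitPoset.mk H y := fun hxy =>
    OrbitPoset.mk_le_mk.2 ⟨1, H.one_mem, hxy⟩
  have hmk : ∀ g ∈ H, ∀ x, OrbitPoset.mk H (g x) = OrbitPoset.mk H x := fun g hg x =>
    OrbitPoset.mk_eq_mk.2 ⟨g, hg, rfl⟩
  refine ⟨ρ', hρ', ?_, ?_, fun a b hab => ?_, fun a b hab => ?_, fun a => ?_⟩
  · have := h.finite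
    exact Finite.of_surjective (OrbitPoset.mk H) OrbitPoset.exists_mk
  · obtain ⟨z, hz, hz0⟩ := h.exists_min
    refine ⟨OrbitPoset.mk H z, fun a => ?_, by rw [hρ', hz0]⟩
    obtain ⟨x, rfl⟩ := a.exists_mk
    exact hle (hz x)
  · obtain ⟨x, rfl⟩ := a.exists_mk
    obtain ⟨y, rfl⟩ := b.exists_mk
    obtain ⟨g, hg, hxy⟩ := hlt hab
    rw [hρ', hρ', ← hinv g hg y]
    exact h.strictMono hxy
  · obtain ⟨x, rfl⟩ := a.exists_mk
    obtain ⟨y, rfl⟩ := b.exists_mk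
    obtain ⟨g, hg, hxy⟩ := hlt hab
    obtain ⟨w, h1, h2, h3⟩ := h.exists_step _ _ hxy
    refine ⟨OrbitPoset.mk H w, (hle h1.le).lt_of_ne fun he => ?_, ?_, by rw [hρ', hρ', h3]⟩
    · have := congrArg ρ' he
      rw [hρ', hρ'] at this
      omega
    · rw [← hmk g hg y]
      exact hle h2
  · obtain ⟨x, rfl⟩ := a.exists_mk
    obtain ⟨y, h1, h2⟩ := h.exists_top x
    exact ⟨OrbitPoset.mk H y, hle h1, by rw [hρ', h2]⟩

end GradedConstructions

/-! ### Groups generated by powers of disjoint cycles -/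

section Cycles

open Equiv

theorem zpow_apply_ne_self_iff {α : Type*} {f : Perm α} {x : α} (s : ℤ) :
    f ((f ^ s) x) ≠ (f ^ s) x ↔ f x ≠ x := by
  rw [← Perm.mul_apply, ← zpow_one_add, add_comm, zpow_add_one, Perm.mul_apply]
  exact (f ^ s).injective.ne_iff

theorem zpow_apply_eq_self_iff_dvd {α : Type*} {f : Perm α} (hf : f.IsCycle) {x : α} (hx : f x ≠ x)
    (s : ℤ) : (f ^ s) x = x ↔ (orderOf f : ℤ) ∣ s := by
  rw [orderOf_dvd_iff_zpow_eq_one]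
  refine ⟨fun h => Perm.ext fun y => ?_, fun h => by rw [h, Perm.one_apply]⟩
  by_cases hy : f y = y
  · exact Perm.zpow_apply_eq_self_of_apply_eq_self hy s
  · obtain ⟨j, rfl⟩ := hf.sameCycle hx hy
    rw [← Perm.mul_apply, ← zpow_add, add_comm, zpow_add, Perm.mul_apply, h, Perm.one_apply]

variable {n m : ℕ} {σ : Fin m → Perm (Fin n)} (r : Fin m → ℕ)
  (hdisj : ∀ i j, i ≠ j → (σ i).Disjoint (σ j))
include hdisj

theorem exists_mem_closure_apply_eq (t : Fin m → ℤ) :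
    ∃ g ∈ Subgroup.closure (Set.range fun i => σ i ^ r i),
      (∀ c x, σ c x ≠ x → g x = (σ c ^ (r c * t c)) x) ∧
      ∀ x, (∀ c, σ c x = x) → g x = x := by
  suffices h : ∀ s : Finset (Fin m), ∃ g ∈ Subgroup.closure (Set.range fun i => σ i ^ r i),
      (∀ c ∈ s, ∀ x, σ c x ≠ x → g x = (σ c ^ (r c * t c)) x) ∧
      ∀ x, (∀ c ∈ s, σ c x = x) → g x = x by
    simpa using h Finset.univ
  intro s
  induction s using Finset.induction_on with
  | empty => exact ⟨1, Subgroup.one_mem _, by simp, by simp⟩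
  | insert d s hd ih =>
    obtain ⟨g, hg, h1, h2⟩ := ih
    refine ⟨g * σ d ^ (r d * t d), Subgroup.mul_mem _ hg ?_, fun c hc x hx => ?_, fun x hx => ?_⟩
    · rw [zpow_mul, zpow_natCast]
      exact Subgroup.zpow_mem _ (Subgroup.subset_closure (Set.mem_range_self d)) _
    · rw [Perm.mul_apply]
      rcases Finset.mem_insert.1 hc with rfl | hc
      · refine h2 _ fun c' hc' => ?_
        have hne : c ≠ c' := fun he => hd (he ▸ hc')
        exact (hdisj c c' hne _).resolve_left ((zpow_apply_ne_self_iff _).2 hx)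
      · have hne : c ≠ d := fun he => hd (he ▸ hc)
        rw [Perm.zpow_apply_eq_self_of_apply_eq_self ((hdisj c d hne x).resolve_left hx)]
        exact h1 c hc x hx
    · rw [Perm.mul_apply,
        Perm.zpow_apply_eq_self_of_apply_eq_self (hx d (Finset.mem_insert_self _ _))]
      exact h2 x fun c hc => hx c (Finset.mem_insert_of_mem hc)

theorem exists_apply_eq_of_mem_closure {g : Perm (Fin n)}
    (hg : g ∈ Subgroup.closure (Set.range fun i => σ i ^ r i)) :
    ∃ t : Fin m → ℤ, (∀ c x, σ c x ≠ x → g x = (σ c ^ (r c * t c)) x) ∧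
      ∀ x, (∀ c, σ c x = x) → g x = x := by
  induction hg using Subgroup.closure_induction with
  | mem g hg =>
    obtain ⟨d, rfl⟩ := hg
    refine ⟨Pi.single d 1, fun c x hx => ?_, fun x hx => ?_⟩
    · rcases eq_or_ne c d with rfl | hne
      · simp
      · rw [Pi.single_eq_of_ne hne, mul_zero, zpow_zero, Perm.one_apply]
        exact Perm.pow_apply_eq_self_of_apply_eq_self ((hdisj c d hne x).resolve_left hx) _
    · exact Perm.pow_apply_eq_self_of_apply_eq_self (hx d) _
  | one => exact ⟨0, by simp, by simp⟩
  | mul g g' _ _ h h' =>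
    obtain ⟨t, h1, h2⟩ := h
    obtain ⟨t', h1', h2'⟩ := h'
    refine ⟨t + t', fun c x hx => ?_, fun x hx => ?_⟩
    · rw [Perm.mul_apply, h1' c x hx, h1 c _ ((zpow_apply_ne_self_iff _).2 hx), Pi.add_apply,
        mul_add, zpow_add, Perm.mul_apply]
    · rw [Perm.mul_apply, h2' x hx, h2 x hx]
  | inv g _ h =>
    obtain ⟨t, h1, h2⟩ := h
    refine ⟨-t, fun c x hx => ?_, fun x hx => ?_⟩
    · rw [Perm.inv_eq_iff_eq, h1 c _ ((zpow_apply_ne_self_iff _).2 hx), ← Perm.mul_apply,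
        ← zpow_add, Pi.neg_apply, mul_neg, add_neg_cancel, zpow_zero, Perm.one_apply]
    · rw [Perm.inv_eq_iff_eq, h2 x hx]

end Cycles

/-- Coordinates on `Fin n` adapted to a group `G` of permutations: `Fin n` is the disjoint union
of cycles, the elements of the cycle `c` being `pt c s` with `s` an integer modulo `k c`, and the
elements of `G` rotate each cycle `c` by an arbitrary multiple of `r c`, independently of each
other. -/
structure CycleCoords {n : ℕ} (G : Subgroup (Equiv.Perm (Fin n))) where
  C : Type
  fintype : Fintype C
  k : C → ℤ
  r : C → ℤ
  pt : C → ℤ → Fin n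
  k_pos : ∀ c, 0 < k c
  pt_eq_iff : ∀ c s s', pt c s = pt c s' ↔ k c ∣ s - s'
  eq_of_pt_eq : ∀ c c' s s', pt c s = pt c' s' → c = c'
  exists_pt : ∀ i, ∃ c s, pt c s = i
  exists_mem : ∀ t : C → ℤ, ∃ g ∈ G, ∀ c s, g (pt c s) = pt c (s + r c * t c)
  exists_of_mem : ∀ g ∈ G, ∃ t : C → ℤ, ∀ c s, g (pt c s) = pt c (s + r c * t c)

open Equiv in
theorem GeneratedByPowersOfDisjointCycles.nonempty_cycleCoords {n : ℕ}
    {G : Subgroup (Equiv.Perm (Fin n))} (hG : GeneratedByPowersOfDisjointCycles G) :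
    Nonempty (CycleCoords G) := by
  classical
  obtain ⟨m, σ, r, hcyc, hdisj, rfl⟩ := hG
  choose b hb hb' using hcyc
  -- the fixed points are treated as cycles of length one
  let pt : Fin m ⊕ {i // ∀ c, σ c i = i} → ℤ → Fin n := fun c s =>
    Sum.elim (fun c => (σ c ^ s) (b c)) (fun i => i.1) c
  have hpt : ∀ c s, σ c (pt (Sum.inl c) s) ≠ pt (Sum.inl c) s := fun c s =>
    (zpow_apply_ne_self_iff s).2 (hb c)
  have hadd : ∀ c s s', (σ c ^ s') (pt (Sum.inl c) s) = pt (Sum.inl c) (s + s') := fun c s s' => by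
    simp only [pt, Sum.elim_inl]
    rw [add_comm, zpow_add, Perm.mul_apply]
  refine ⟨{
    C := Fin m ⊕ {i // ∀ c, σ c i = i}
    fintype := inferInstance
    k := Sum.elim (fun c => orderOf (σ c)) (fun _ => 1)
    r := Sum.elim (fun c => r c) (fun _ => 0)
    pt := pt
    k_pos := ?_
    pt_eq_iff := ?_
    eq_of_pt_eq := ?_
    exists_pt := ?_
    exists_mem := ?_
    exists_of_mem := ?_ }⟩
  · rintro (c | i)
    · simpa using orderOf_pos (σ c)
    · simp
  · rintro (c | i) s s'
    · simp only [pt, Sum.elim_inl]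
      rw [← zpow_apply_eq_self_iff_dvd ⟨b c, hb c, fun y => @hb' c y⟩ (hb c), sub_eq_add_neg,
        add_comm, zpow_add, Perm.mul_apply, zpow_neg, Perm.inv_eq_iff_eq]
    · simp [pt]
  · rintro (c | i) (c' | i') s s' h
    · by_contra hne
      have h1 := hpt c s
      have h2 := hpt c' s'
      rw [← h] at h2
      exact (hdisj c c' (fun he => hne (he ▸ rfl)) _).elim h1 h2
    · exact absurd (i'.2 c) (by have h1 := hpt c s; rwa [h] at h1)
    · exact absurd (i.2 c') (by have h1 := hpt c' s'; rwa [← h] at h1)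
    · exact congrArg Sum.inr (Subtype.ext h)
  · intro i
    by_cases hi : ∀ c, σ c i = i
    · exact ⟨Sum.inr ⟨i, hi⟩, 0, rfl⟩
    · push Not at hi
      obtain ⟨c, hc⟩ := hi
      obtain ⟨s, hs⟩ := hb' c hc
      exact ⟨Sum.inl c, s, hs⟩
  · intro t
    obtain ⟨g, hg, h1, h2⟩ := exists_mem_closure_apply_eq r hdisj fun c => t (Sum.inl c)
    refine ⟨g, hg, ?_⟩
    rintro (c | i) s
    · rw [h1 c _ (hpt c s), hadd]
      rfl
    · exact h2 _ i.2
  · intro g hg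
    obtain ⟨t, h1, h2⟩ := exists_apply_eq_of_mem_closure r hdisj hg
    refine ⟨Sum.elim t fun _ => 0, ?_⟩
    rintro (c | i) s
    · rw [h1 c _ (hpt c s), hadd]
      rfl
    · exact h2 _ i.2

/-! ### Quotients of powers -/

theorem CycleCoords.sum_eq {n : ℕ} {G : Subgroup (Equiv.Perm (Fin n))} (K : CycleCoords G)
    (F : Fin n → ℕ) :
    letI := K.fintype
    ∑ i, F i = ∑ c, ∑ l ∈ Finset.Ioc 0 (K.k c), F (K.pt c l) := by
  let := K.fintype
  rw [Finset.sum_sigma']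
  symm
  refine Finset.sum_bij (fun p _ => K.pt p.1 p.2) (fun _ _ => Finset.mem_univ _) ?_ ?_
    (fun _ _ => rfl)
  · rintro ⟨c, l⟩ h ⟨c', l'⟩ h' he
    obtain rfl := K.eq_of_pt_eq _ _ _ _ he
    simp only [Finset.mem_sigma, Finset.mem_univ, true_and, Finset.mem_Ioc] at h h'
    have h1 := (K.pt_eq_iff _ _ _).1 he
    dsimp only at h1
    have h2 : l - l' = 0 := Int.eq_zero_of_abs_lt_dvd h1 (abs_lt.2 ⟨by omega, by omega⟩)
    rw [show l = l' by omega]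
  · intro i _
    obtain ⟨c, s, rfl⟩ := K.exists_pt i
    obtain ⟨l, t, h1, h2, rfl, -⟩ := exists_window (K.k_pos c) 0 s
    exact ⟨⟨c, l⟩, by simp; omega, (K.pt_eq_iff _ _ _).2 ⟨-t, by ring⟩⟩

theorem theorem2 {P : Type*} [PartialOrder P] (hP : IsSCO P) (n : ℕ)
    (G : Subgroup (Equiv.Perm (Fin n))) (hG : GeneratedByPowersOfDisjointCycles G) :
    IsSCO (PowerQuotient P G) := by
  classical
  obtain ⟨ρ, N, hρ, ⟨D⟩⟩ := isSCO_iff.1 hP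
  have := hρ.finite
  obtain ⟨z₀, -⟩ := hρ.exists_min
  obtain ⟨K⟩ := hG.nonempty_cycleCoords
  let := K.fintype
  have hpow := hρ.pi (ι := Fin n)
  obtain ⟨ρ', hρ', hgr⟩ := hpow.exists_orbitPoset (H := G.map (permCoords P n)) (by
    rintro _ ⟨g, -, rfl⟩ x
    exact Equiv.sum_comp g⁻¹ fun i => ρ (x i))
  have hne : ∀ c, Nonempty (PeriodicSeq P (K.k c)) := fun c => ⟨⟨fun _ => z₀, fun _ => rfl⟩⟩
  obtain ⟨E⟩ := SymmChainData.nonempty_pi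
    (fun c => (SymmChainData.nonempty_periodicSeq D (K.k_pos c) (K.r c)).some)
    (fun c z => ⟨0, by simp⟩)
    (by rintro c _ z ⟨t, rfl⟩; exact seqRank_shift (K.k_pos c) ρ z _) Finset.univ
  choose co pos hpos using K.exists_pt
  -- `φ` assembles a function on `Fin n` from its restrictions to the cycles
  let φ : (∀ c, PeriodicSeq P (K.k c)) → Fin n → P := fun z i => (z (co i)).1 (pos i)
  have hφ : ∀ z c s, φ z (K.pt c s) = (z c).1 s := by
    intro z c s
    have h1 := hpos (K.pt c s)
    simp only [φ]
    generalize pos (K.pt c s) = s' at h1 ⊢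
    generalize co (K.pt c s) = c' at h1 ⊢
    obtain rfl := K.eq_of_pt_eq _ _ _ _ h1
    obtain ⟨t, ht⟩ := (K.pt_eq_iff _ _ _).1 h1
    rw [show s' = s + t * K.k c' by linarith, apply_add_mul_of_periodic (z c').2]
  have hrank : ∀ z, ρ' (OrbitPoset.mk _ (φ z)) = ∑ c, seqRank ρ (z c) := by
    intro z
    rw [hρ', K.sum_eq]
    simp only [hφ]
    rfl
  have htotal : ∑ _i : Fin n, N = ∑ c, N * (K.k c).toNat := by
    rw [K.sum_eq]
    simp [mul_comm]
  refine isSCO_iff.2 ⟨ρ', _, hgr, ?_⟩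
  rw [htotal]
  refine ⟨E.map (fun z => OrbitPoset.mk _ (φ z)) hrank ?_ ?_ ?_⟩
  · intro z z' h
    choose t ht using fun c => h c (Finset.mem_univ c)
    obtain ⟨g, hg, hgt⟩ := K.exists_mem t
    refine OrbitPoset.mk_le_mk.2 ⟨permCoords P n g⁻¹, ⟨_, G.inv_mem hg, rfl⟩, fun i => ?_⟩
    obtain ⟨c, s, rfl⟩ := K.exists_pt i
    change _ ≤ φ z' (g⁻¹⁻¹ _)
    rw [inv_inv, hgt, hφ, hφ]
    exact ht c s
  · intro y
    obtain ⟨x, rfl⟩ := y.exists_mk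
    let w : ∀ c, PeriodicSeq P (K.k c) := fun c => ⟨fun s => x (K.pt c s), fun s => by
      dsimp only
      rw [(K.pt_eq_iff c (s + K.k c) s).2 (by simp)]⟩
    have hx : φ w = x := by
      funext i
      obtain ⟨c, s, rfl⟩ := K.exists_pt i
      exact hφ w c s
    refine ⟨w, by rw [← hrank, hx], fun z h => ?_⟩
    choose t ht using fun c => h c (Finset.mem_univ c)
    obtain ⟨g, hg, hgt⟩ := K.exists_mem t
    refine OrbitPoset.mk_eq_mk.2 ⟨permCoords P n g⁻¹, ⟨_, G.inv_mem hg, rfl⟩, funext fun i => ?_⟩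
    obtain ⟨c, s, rfl⟩ := K.exists_pt i
    change x (g⁻¹⁻¹ _) = _
    rw [inv_inv, hgt, hφ, ht]
    rfl
  · intro z z' h c _
    obtain ⟨_, ⟨g, hg, rfl⟩, h1⟩ := OrbitPoset.mk_eq_mk.1 h
    obtain ⟨t, ht⟩ := K.exists_of_mem g⁻¹ (G.inv_mem hg)
    refine ⟨t c, Subtype.ext (funext fun s => ?_)⟩
    have h2 := congrFun h1 (K.pt c s)
    change φ z' (g⁻¹ _) = _ at h2
    rw [ht, hφ, hφ] at h2
    exact h2.symm
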